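/- Let $\mathcal H_0$ be a complex Hilbert space with norm $\|\cdot\|_0$, and let $\mathcal G_0$ be a Hilbert space consisting of the same elements with an equivalent norm $|\cdot|_0$. Let $A$ be a positive definite selfadjoint operator in $\mathcal H_0$ (selfadjoint with $\langle Au,u\rangle\ge\alpha\|u\|_0^2$ on $\mathcal D(A)$ for some $\alpha>0$), and let $M$ be a positive definite selfadjoint operator in $\mathcal G_0$ with $M^{-1}$ compact. Let $0<\mu_1\le\mu_2\le\dots\to\infty$ be the eigenvalues of $M$, counted according to multiplicity, with corresponding eigenvectors $q_1,q_2,\dots$ orthonormal in $\mathcal G_0$. Fractional powers are those of the spectral theorem. Let $\mathcal H_{1/2}=\mathcal D(A^{1/2})$, with inner product $\langle u,v\rangle_{1/2}=\langle A^{1/2}u,A^{1/2}v\rangle$ and norm $\|\cdot\|_{1/2}$. Assume that $\mathcal D(A)=\mathcal D(M)$ and that the norms $\|Av\|_0$ and $|Mv|_0$ are equivalent on this space. Let $P_{n,1/2}$ be the $\mathcal H_{1/2}$-orthogonal projection onto $\mathrm{span}\{q_1,\dots,q_n\}$, and let $\sigma\ge 1/2$. (i) If $v\in\mathcal D(M^\sigma)$,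 then $v\in\mathcal H_{1/2}$ and $$\|v-P_{n,1/2}v\|_0=o(\mu_{n+1}^{-\sigma})\quad\text{as } n\to\infty .$$ (ii) Let $\lambda_1\le\lambda_2\le\dots$ be the eigenvalues of $A$, counted according to multiplicity, with corresponding eigenvectors $u_1,u_2,\dots$ orthonormal in $\mathcal H_0$. For each $n$ let $\Lambda^{(n)}_1\le\dots\le\Lambda^{(n)}_n$ and $u^{(n,1/2)}_1,\dots,u^{(n,1/2)}_n$ (orthonormal in $\mathcal H_0$) be the eigenvalues and eigenvectors given by the regular Rayleigh–Ritz method for $A$ with trial vectors $q_1,\dots,q_n$, that is, by the matrix eigenvalue problem $[\langle q_i,q_k\rangle_{1/2}]\,x=\Lambda\,[\langle q_i,q_k\rangle_0]\,x$. If $u_1,\dots,u_\ell\in\mathcal D(M^\sigma)$, then for each $1\le j\le\ell$ one has $\Lambda^{(n)}_j=\lambda_j+o(\mu_{n+1}^{1-2\sigma})$, and there are eigenvectors $u_{j,n}$ of $A$ for the eigenvalue $\lambda_j$, with $\|u_{j,n}\|_0=1$, such that, as $n\to\infty$, $$\|u_{j,n}-u^{(n,1/2)}_j\|_{1/2}=o(\mu_{n+1}^{1/2-\sigma})\quad\text{and}\quad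 \|u_{j,n}-u^{(n,1/2)}_j\|_0=o(\mu_{n+1}^{-\sigma}).$$ -/

import Mathlib

noncomputable section

/-- A positive definite selfadjoint (in general unbounded) operator in a complex Hilbert space:
a selfadjoint, hence densely defined and closed, partially defined linear operator with a strictly
positive lower bound. -/
structure PosDefOperator (H : Type*) [NormedAddCommGroup H] [InnerProductSpace ℂ H]
    [CompleteSpace H] where
  /-- the operator, with its domain -/
  op : H →ₗ.[ℂ] H
  selfAdjoint : IsSelfAdjoint op
  posDef : ∃ α : ℝ, 0 < α ∧ ∀ u : op.domain, α * ‖(u : H)‖ ^ 2 ≤ (inner ℂ (op u) (u : H)).re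

namespace PosDefOperator

variable {H : Type*} [NormedAddCommGroup H] [InnerProductSpace ℂ H] [CompleteSpace H]

/-- The domain `D(A)`. -/
def domain (A : PosDefOperator H) : Submodule ℂ H := A.op.domain

/-- The action `A u` for `u ∈ D(A)`. -/
def app (A : PosDefOperator H) (u : A.domain) : H := A.op u

theorem bounded_below (A : PosDefOperator H) :
    ∃ K : ℝ, 0 < K ∧ ∀ u : A.op.domain, ‖(u : H)‖ ≤ K * ‖A.op u‖ := by
  obtain ⟨α, hα, h⟩ := A.posDef
  refine ⟨α⁻¹, inv_pos.2 hα, fun u => ?_⟩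
  have h1 : α * ‖(u : H)‖ ^ 2 ≤ ‖A.op u‖ * ‖(u : H)‖ :=
    ((h u).trans (Complex.re_le_norm _)).trans (norm_inner_le_norm _ _)
  rcases (norm_nonneg (u : H)).eq_or_lt with h0 | h0
  · rw [← h0]; positivity
  · rw [inv_mul_eq_div, le_div_iff₀ hα]
    nlinarith

theorem bijective (A : PosDefOperator H) : Function.Bijective A.op.toFun := by
  obtain ⟨K, hK, hb⟩ := A.bounded_below
  constructor
  · rw [injective_iff_map_eq_zero]
    intro u hu
    have h1 := hb u
    rw [show A.op u = 0 from hu, norm_zero, mul_zero] at h1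
    exact Subtype.ext (norm_le_zero_iff.1 h1)
  · have hcl : IsClosed (A.op.graph : Set (H × H)) := A.selfAdjoint.isClosed
    have : CompleteSpace A.op.graph := hcl.completeSpace_coe
    let g : A.op.graph →L[ℂ] H := (ContinuousLinearMap.snd ℂ H H).comp A.op.graph.subtypeL
    have hanti : AntilipschitzWith (Real.toNNReal (max K 1)) g := by
      refine g.antilipschitz_of_bound fun p => ?_
      rw [Real.coe_toNNReal _ (le_max_of_le_right zero_le_one)]
      obtain ⟨⟨x, y⟩, hp⟩ := p
      obtain ⟨u, hu1, hu2⟩ := (LinearPMap.mem_graph_iff _).1 hp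
      change max ‖x‖ ‖y‖ ≤ max K 1 * ‖y‖
      simp only at hu1 hu2
      refine max_le ?_ ?_
      · rw [← hu1, ← hu2]
        exact (hb u).trans (mul_le_mul_of_nonneg_right (le_max_left _ _) (norm_nonneg _))
      · exact le_mul_of_one_le_left (norm_nonneg _) (le_max_right _ _)
    have hrc : IsClosed (Set.range g) := hanti.isClosed_range g.uniformContinuous
    have hrange : Set.range g = (LinearMap.range A.op.toFun : Set H) := by
      ext y
      constructor
      · rintro ⟨⟨⟨x, z⟩, hp⟩, rfl⟩
        obtain ⟨u, hu1, hu2⟩ := (LinearPMap.mem_graph_iff _).1 hp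
        exact ⟨u, hu2⟩
      · rintro ⟨u, rfl⟩
        exact ⟨⟨((u : H), A.op u), A.op.mem_graph u⟩, rfl⟩
    rw [hrange] at hrc
    rw [← LinearMap.range_eq_top]
    have : CompleteSpace (LinearMap.range A.op.toFun) := hrc.completeSpace_coe
    rw [← Submodule.orthogonal_eq_bot_iff, Submodule.eq_bot_iff]
    intro y hy
    have hy0 : ∀ x : A.op.domain, inner ℂ (0 : H) (x : H) = inner ℂ y (A.op x) := by
      intro x
      rw [inner_zero_left]
      exact (((Submodule.mem_orthogonal' _ _).1 hy) _ ⟨x, rfl⟩).symm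
    have hmem := LinearPMap.mem_adjoint_domain_of_exists (T := A.op) y ⟨0, hy0⟩
    have happ := LinearPMap.adjoint_apply_eq A.selfAdjoint.dense_domain ⟨y, hmem⟩ hy0
    have hs : A.op.adjoint = A.op := LinearPMap.isSelfAdjoint_def.1 A.selfAdjoint
    have hgr : (y, (0 : H)) ∈ A.op.graph := by
      rw [← hs]
      exact (LinearPMap.mem_graph_iff _).2 ⟨⟨y, hmem⟩, rfl, happ⟩
    obtain ⟨u, hu1, hu2⟩ := (LinearPMap.mem_graph_iff _).1 hgr
    have h1 := hb u
    simp only at hu1 hu2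
    rw [hu2, hu1, norm_zero, mul_zero] at h1
    exact norm_le_zero_iff.1 h1

/-- `A : D(A) → H` as a linear bijection. -/
def equiv (A : PosDefOperator H) : A.op.domain ≃ₗ[ℂ] H :=
  LinearEquiv.ofBijective A.op.toFun A.bijective

/-- The inverse `A⁻¹`, a bounded everywhere defined operator. -/
def inv (A : PosDefOperator H) : H →L[ℂ] H :=
  (A.op.domain.subtype ∘ₗ (A.equiv.symm : H →ₗ[ℂ] A.op.domain)).mkContinuousOfExistsBound (by
    obtain ⟨K, _, hb⟩ := A.bounded_below
    refine ⟨K, fun x => ?_⟩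
    have h1 : A.op (A.equiv.symm x) = x := A.equiv.apply_symm_apply x
    have h2 := hb (A.equiv.symm x)
    rw [h1] at h2
    exact h2)

theorem inv_app (A : PosDefOperator H) (u : A.domain) : A.inv (A.app u) = u :=
  congrArg Subtype.val (A.equiv.symm_apply_apply u)

theorem inv_mem (A : PosDefOperator H) (x : H) : A.inv x ∈ A.domain :=
  (A.equiv.symm x).2

theorem app_inv (A : PosDefOperator H) (x : H) : A.app ⟨A.inv x, A.inv_mem x⟩ = x :=
  A.equiv.apply_symm_apply x

theorem inv_nonneg (A : PosDefOperator H) : 0 ≤ A.inv := by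
  have hfa : ∀ x y : A.op.domain, inner ℂ (A.op x) (y : H) = inner ℂ (x : H) (A.op y) := by
    have h := LinearPMap.adjoint_isFormalAdjoint (T := A.op) A.selfAdjoint.dense_domain
    rw [LinearPMap.isSelfAdjoint_def.1 A.selfAdjoint] at h
    exact h
  rw [ContinuousLinearMap.nonneg_iff_isPositive]
  refine ⟨fun x y => ?_, fun x => ?_⟩
  · have h := hfa ⟨A.inv x, A.inv_mem x⟩ ⟨A.inv y, A.inv_mem y⟩
    have hx : A.op ⟨A.inv x, A.inv_mem x⟩ = x := A.app_inv x
    have hy : A.op ⟨A.inv y, A.inv_mem y⟩ = y := A.app_inv y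
    rw [hx, hy] at h
    exact h.symm
  · obtain ⟨α, hα, hb⟩ := A.posDef
    have h := hb ⟨A.inv x, A.inv_mem x⟩
    have hx : A.op ⟨A.inv x, A.inv_mem x⟩ = x := A.app_inv x
    rw [hx] at h
    have h0 : 0 ≤ α * ‖A.inv x‖ ^ 2 := by positivity
    rw [ContinuousLinearMap.reApplyInnerSelf_apply]
    change 0 ≤ (inner ℂ (A.inv x) x).re
    rw [← inner_conj_symm, Complex.conj_re]
    exact h0.trans h

theorem inv_injective (A : PosDefOperator H) : Function.Injective A.inv := by
  intro x y h
  rw [← A.app_inv x, ← A.app_inv y]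
  congr 1
  exact Subtype.ext h

/-- The power `A^τ`, `τ > 0`, of the spectral theorem, as an unbounded operator: it is the inverse
of the bounded injective operator `(A⁻¹)^τ` given by the continuous functional calculus. -/
def rpow (A : PosDefOperator H) (τ : ℝ) : H →ₗ.[ℂ] H :=
  (((A.inv ^ τ : H →L[ℂ] H) : H →ₗ[ℂ] H).toPMap ⊤).inverse

theorem mem_rpow_domain (A : PosDefOperator H) (τ : ℝ) (u : H) :
    u ∈ (A.rpow τ).domain ↔ ∃ x, (A.inv ^ τ : H →L[ℂ] H) x = u := by
  rw [rpow, LinearPMap.inverse_domain]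
  constructor
  · rintro ⟨x, rfl⟩; exact ⟨x, rfl⟩
  · rintro ⟨x, rfl⟩; exact ⟨⟨x, trivial⟩, rfl⟩

theorem inv_half_mul (A : PosDefOperator H) (x : H) :
    (A.inv ^ (1 / 2 : ℝ) : H →L[ℂ] H) ((A.inv ^ (1 / 2 : ℝ) : H →L[ℂ] H) x) = A.inv x := by
  have h := CFC.sqrt_mul_sqrt_self A.inv A.inv_nonneg
  rw [CFC.sqrt_eq_rpow] at h
  exact DFunLike.congr_fun h x

theorem inv_half_injective (A : PosDefOperator H) :
    Function.Injective (A.inv ^ (1 / 2 : ℝ) : H →L[ℂ] H) := by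
  intro x y h
  apply A.inv_injective
  rw [← A.inv_half_mul x, ← A.inv_half_mul y, h]

/-- The space `H_{1/2}`: the domain of `A^{1/2}` (the form domain of `A`). It is kept as a type of
its own since its norm is not the one inherited from `H`. -/
def EnergySpace (A : PosDefOperator H) : Type _ := (A.rpow (1 / 2)).domain

namespace EnergySpace

variable {A : PosDefOperator H}

instance : AddCommGroup A.EnergySpace := inferInstanceAs (AddCommGroup (A.rpow (1 / 2)).domain)
instance : Module ℂ A.EnergySpace := inferInstanceAs (Module ℂ (A.rpow (1 / 2)).domain)

/-- The inclusion of `H_{1/2}` in `H`. -/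
def incl (A : PosDefOperator H) : A.EnergySpace →ₗ[ℂ] H := (A.rpow (1 / 2)).domain.subtype

/-- `A^{1/2}` as a linear map from its domain to `H`. -/
def half (A : PosDefOperator H) : A.EnergySpace →ₗ[ℂ] H := (A.rpow (1 / 2)).toFun

theorem inv_half_half (u : A.EnergySpace) :
    (A.inv ^ (1 / 2 : ℝ) : H →L[ℂ] H) (half A u) = incl A u := by
  obtain ⟨x, hx⟩ := (A.mem_rpow_domain _ _).1 u.2
  have hker : LinearMap.ker
      (((A.inv ^ (1 / 2 : ℝ) : H →L[ℂ] H) : H →ₗ[ℂ] H).toPMap ⊤).toFun = ⊥ := by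
    rw [LinearMap.ker_eq_bot]
    intro a b hab
    exact Subtype.ext (A.inv_half_injective hab)
  have h : (A.rpow (1 / 2)) u = x :=
    LinearPMap.inverse_apply_eq hker (y := u) (x := ⟨x, trivial⟩) hx
  change (A.inv ^ (1 / 2 : ℝ) : H →L[ℂ] H) ((A.rpow (1 / 2)) u) = _
  rw [h, hx]
  rfl

/-- The energy inner product `⟨u, v⟩_{1/2} = ⟨A^{1/2} u, A^{1/2} v⟩`. -/
@[reducible] def core (A : PosDefOperator H) : InnerProductSpace.Core ℂ A.EnergySpace where
  inner u v := inner ℂ (half A u) (half A v)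
  conj_inner_symm u v := inner_conj_symm _ _
  re_inner_nonneg u := inner_self_nonneg
  add_left u v w := by simp only [map_add, inner_add_left]
  smul_left u v r := by simp only [map_smul, inner_smul_left]
  definite u hu := by
    have h0 : half A u = 0 := inner_self_eq_zero.1 hu
    have h1 := inv_half_half u
    rw [h0, map_zero] at h1
    exact Subtype.ext h1.symm

instance : NormedAddCommGroup A.EnergySpace :=
  @InnerProductSpace.Core.toNormedAddCommGroup ℂ _ _ _ _ (core A)

instance : InnerProductSpace ℂ A.EnergySpace := InnerProductSpace.ofCore (core A).toCore

/-- Elements of `D(A)`, regarded as elements of `H_{1/2}`. -/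
def ofDomain (A : PosDefOperator H) (u : A.domain) : A.EnergySpace :=
  ⟨u, (A.mem_rpow_domain _ _).2
    ⟨(A.inv ^ (1 / 2 : ℝ) : H →L[ℂ] H) (A.app u), by rw [A.inv_half_mul, A.inv_app]⟩⟩

end EnergySpace

/-- `μ` lists all the eigenvalues of `A` in increasing order, repeated according to multiplicity,
and `q` is a corresponding orthonormal sequence of eigenvectors. The index starts at `0`. -/
structure IsEigenListing (A : PosDefOperator H) (μ : ℕ → ℝ) (q : ℕ → H) : Prop where
  monotone : Monotone μ
  orthonormal : Orthonormal ℂ q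
  mem : ∀ k, q k ∈ A.domain
  eigen : ∀ k, A.app ⟨q k, mem k⟩ = (μ k : ℂ) • q k
  complete : ∀ (ν : ℝ) (x : A.domain), A.app x = (ν : ℂ) • (x : H) →
    (x : H) ∈ Submodule.span ℂ (q '' {k | μ k = ν})

/-- The span of the first `n` trial vectors, in `H_{1/2}`. -/
def trialSpace (A : PosDefOperator H) (w : ℕ → A.EnergySpace) (n : ℕ) :
    Submodule ℂ A.EnergySpace :=
  Submodule.span ℂ (Set.range fun i : Fin n => w i)

instance (A : PosDefOperator H) (w : ℕ → A.EnergySpace) (n : ℕ) :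
    FiniteDimensional ℂ (A.trialSpace w n) :=
  FiniteDimensional.span_of_finite ℂ (Set.finite_range _)

/-- `P_{n,1/2}`: the orthogonal projection in `H_{1/2}` onto the span of the first `n` trial
vectors. -/
def energyProj (A : PosDefOperator H) (w : ℕ → A.EnergySpace) (n : ℕ) :
    A.EnergySpace →L[ℂ] A.EnergySpace :=
  (A.trialSpace w n).starProjection

/-- `Λ_0 ≤ ⋯ ≤ Λ_{n-1}` and `U_0, …, U_{n-1}` are the eigenvalues and eigenvectors obtained by the
regular Rayleigh-Ritz method from the first `n` trial vectors: the coefficient vectors `x_j` of the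
`U_j` solve `[⟨w_i, w_k⟩_{1/2}] x_j = Λ_j [⟨w_i, w_k⟩_0] x_j`, and the `U_j` are orthonormal
in `H`. -/
structure IsRitzSystem (A : PosDefOperator H) (w : ℕ → A.EnergySpace) (n : ℕ)
    (Λ : Fin n → ℝ) (U : Fin n → A.EnergySpace) : Prop where
  monotone : Monotone Λ
  orthonormal : Orthonormal ℂ fun j => EnergySpace.incl A (U j)
  eigen : ∀ j, ∃ x : Fin n → ℂ, U j = ∑ k, x k • w k ∧
    (Matrix.of fun i k : Fin n => inner ℂ (w i) (w k)).mulVec x =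
      (Λ j : ℂ) • (Matrix.of fun i k : Fin n =>
        inner ℂ (EnergySpace.incl A (w i)) (EnergySpace.incl A (w k))).mulVec x

end PosDefOperator

end

/-!
The energy norm `‖·‖_{1/2}` is the natural one for the Galerkin projection, and everything is reduced
to one approximation estimate in it.

*Approximation.* The operator `J* A J M⁻¹` is bounded on `G` and symmetric for the weaker inner
product `⟪M⁻¹ x, y⟫`, so by the inequality of Lax and Krein (`norm_map_le_of_symmetrizable`) it is
bounded for that one too; this says that the quadratic form of `A` is dominated by that of `M`
(`exists_energy_le`), with no interpolation theory. Hence the energy norm of `∑ c k • q k` is at most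
a constant times `(∑ μ k * ‖c k‖ ^ 2) ^ (1/2)`, and since the projection is the best approximation,
the energy error for `v ∈ D(M^σ)` is `o(μ n ^ (1/2 - σ))`: a factor `μ n ^ (1/2 - σ)` comes from the
frequencies `k ≥ n` and the `o` from the tail of a convergent series (`exists_energy_error_le`). For
solutions of `A φ = f` the same estimate with exponent `1` gives the error
`O(μ n ^ (-1/2)) * ‖f‖`, and the duality argument of Aubin and Nitsche (`norm_incl_error_le`) turns
this into a gain of `μ n ^ (-1/2)` for the `H`-norm of the error of any element.

*Ritz values.* The operator `A⁻¹` is compact as well, so its eigenvectors form a Hilbert basis, and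
the minimum principles in `H_{1/2}` and in the trial space hold. Testing the latter with
projections of combinations of `u 0, …, u j` bounds `Λ j - lam j` by the square of the energy errors
(`eigenvalue_le`, `ritz_mul_le`).

*Ritz vectors.* Let `U` be the `j`-th Ritz vector, and split off its part in the eigenspace of
`lam j`. The components along smaller eigenvalues are controlled by the `H`-norm of the projection
errors of the corresponding `u k`, where `k < j` (`sub_mul_norm_coeff_le`). The part above `lam j` is
controlled in energy by the excess `Λ j - lam j`, as `‖U‖_{1/2} ^ 2 = Λ j` (`norm_sq_upper_le`), and
in `H` by another duality argument (`norm_incl_upper_le`). Only the vectors `u k` with `k ≤ j` have to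
be smooth, even if the eigenspace of `lam j` contains further ones. The approximating eigenvector is
the normalized eigenspace part of `U`.
-/

/-! ### Symmetrizable operators and the functional calculus on eigenvectors -/

/-- The inequality of Lax and Krein: an operator `S` that is bounded, and symmetric for the weaker
semi-inner product `⟪D x, D y⟫`, is bounded for that semi-inner product, with the same bound. -/
theorem norm_map_le_of_symmetrizable {X Y : Type*}
    [NormedAddCommGroup X] [InnerProductSpace ℂ X]
    [NormedAddCommGroup Y] [InnerProductSpace ℂ Y]
    (D : X →L[ℂ] Y) (S : X → X) {K : ℝ} (hK : 0 < K) (hS : ∀ x, ‖S x‖ ≤ K * ‖x‖)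
    (hsymm : ∀ x y, inner ℂ (D (S x)) (D y) = inner ℂ (D x) (D (S y))) (x : X) :
    ‖D (S x)‖ ≤ K * ‖D x‖ := by
  have hiter : ∀ (m : ℕ) (x y : X),
      inner ℂ (D (S^[m] x)) (D y) = inner ℂ (D x) (D (S^[m] y)) := by
    intro m
    induction m with
    | zero => intro x y; rfl
    | succ m ih =>
      intro x y
      rw [Function.iterate_succ_apply, Function.iterate_succ_apply', ih, hsymm]
  have hbound : ∀ m : ℕ, ‖S^[m] x‖ ≤ K ^ m * ‖x‖ := by
    intro m
    induction m with
    | zero => simp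
    | succ m ih =>
      rw [Function.iterate_succ_apply', pow_succ']
      calc _ ≤ K * ‖S^[m] x‖ := hS _
        _ ≤ K * (K ^ m * ‖x‖) := by gcongr
        _ = _ := by ring
  -- by symmetry, doubling the number of iterations squares the growth of `‖D (S^[m] x)‖ / ‖D x‖`
  have hdouble : ∀ m : ℕ, ‖D (S^[m] x)‖ ^ 2 ≤ ‖D x‖ * ‖D (S^[m + m] x)‖ := by
    intro m
    have h1 : inner ℂ (D (S^[m] x)) (D (S^[m] x)) = inner ℂ (D x) (D (S^[m + m] x)) := by
      rw [hiter, ← Function.iterate_add_apply]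
    calc ‖D (S^[m] x)‖ ^ 2 = ‖(inner ℂ (D (S^[m] x)) (D (S^[m] x)) : ℂ)‖ := by
          rw [inner_self_eq_norm_sq_to_K, norm_pow, RCLike.norm_ofReal, abs_norm]
      _ ≤ _ := by rw [h1]; exact norm_inner_le_norm _ _
  -- growth faster than `K ^ m` contradicts the bound on `S`
  by_contra! hlt
  have ha : 0 < ‖D x‖ := by
    refine (norm_nonneg _).lt_of_ne fun h0 => ?_
    have h1 := hdouble 1
    rw [← h0, zero_mul, Function.iterate_one] at h1
    rw [← h0, mul_zero] at hlt
    nlinarith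
  set s : ℝ := ‖D (S x)‖ / ‖D x‖ with hs
  have hsK : K < s := (lt_div_iff₀ ha).2 hlt
  have hgrow : ∀ k : ℕ, ‖D x‖ * s ^ 2 ^ k ≤ ‖D (S^[2 ^ k] x)‖ := by
    intro k
    induction k with
    | zero => rw [pow_zero, pow_one, Function.iterate_one, hs, mul_div_cancel₀ _ ha.ne']
    | succ k ih =>
      refine le_of_mul_le_mul_left ?_ ha
      have h1 := hdouble (2 ^ k)
      rw [pow_succ 2 k, mul_two]
      refine le_trans ?_ h1
      have h2 : 0 ≤ ‖D x‖ * s ^ 2 ^ k := by positivity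
      calc ‖D x‖ * (‖D x‖ * s ^ (2 ^ k + 2 ^ k)) = (‖D x‖ * s ^ 2 ^ k) ^ 2 := by ring
        _ ≤ _ := pow_le_pow_left₀ h2 ih 2
  have hlim : Filter.Tendsto (fun k : ℕ => (s / K) ^ 2 ^ k) Filter.atTop Filter.atTop :=
    (tendsto_pow_atTop_atTop_of_one_lt ((one_lt_div hK).2 hsK)).comp
      (tendsto_pow_atTop_atTop_of_one_lt one_lt_two)
  obtain ⟨k, hk⟩ := (hlim.eventually_gt_atTop (‖D‖ * ‖x‖ / ‖D x‖)).exists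
  refine absurd hk (not_lt.2 ?_)
  rw [div_pow, div_le_div_iff₀ (by positivity) ha]
  calc s ^ 2 ^ k * ‖D x‖ ≤ ‖D (S^[2 ^ k] x)‖ := by rw [mul_comm]; exact hgrow k
    _ ≤ ‖D‖ * ‖S^[2 ^ k] x‖ := D.le_opNorm _
    _ ≤ ‖D‖ * (K ^ 2 ^ k * ‖x‖) := by gcongr; exact hbound _
    _ = _ := by ring

/-- The continuous functional calculus acts on eigenvectors through the eigenvalue. -/
theorem rpow_apply_eigenvector {X : Type*} [NormedAddCommGroup X] [InnerProductSpace ℂ X]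
    [CompleteSpace X] (B : X →L[ℂ] X) (hB : 0 ≤ B) {q : X} {ν : ℝ} (hν : 0 ≤ ν)
    (hq : B q = (ν : ℂ) • q) {τ : ℝ} (hτ : 0 ≤ τ) :
    (B ^ τ : X →L[ℂ] X) q = ((ν ^ τ : ℝ) : ℂ) • q := by
  rcases eq_or_ne q 0 with rfl | hq0
  · simp
  have : Nontrivial X := ⟨q, 0, hq0⟩
  have hνB : ν ≤ ‖B‖ := by
    refine le_of_mul_le_mul_right ?_ (norm_pos_iff.2 hq0)
    calc ν * ‖q‖ = ‖B q‖ := by rw [hq, norm_smul, Complex.norm_real, Real.norm_of_nonneg hν]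
      _ ≤ _ := B.le_opNorm q
  have hsa : IsSelfAdjoint B := .of_nonneg hB
  have hcont : Continuous fun x : ℝ => ((x.toNNReal ^ τ : NNReal) : ℝ) :=
    NNReal.continuous_coe.comp ((NNReal.continuous_rpow_const hτ).comp continuous_real_toNNReal)
  have hpoly : ∀ p : Polynomial ℝ, (Polynomial.aeval B p) q = ((p.eval ν : ℝ) : ℂ) • q := by
    intro p
    induction p using Polynomial.induction_on' with
    | add p r hp hr => simp [hp, hr, add_smul]
    | monomial n a =>
      have : ∀ n : ℕ, (B ^ n) q = ((ν ^ n : ℝ) : ℂ) • q := by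
        intro n
        induction n with
        | zero => simp
        | succ n ih =>
          rw [pow_succ', mul_apply_eq_comp, ih, map_smul, hq, smul_smul]
          push_cast; ring_nf
      rw [Polynomial.aeval_monomial, mul_apply_eq_comp, this]
      rw [Polynomial.eval_monomial, Complex.ofReal_mul, mul_smul]
      exact algebraMap_smul ℂ a _
  have hνs : ((ν.toNNReal ^ τ : NNReal) : ℝ) = ν ^ τ := by
    rw [NNReal.coe_rpow, Real.coe_toNNReal _ hν]
  rw [CFC.rpow_def, cfc_nnreal_eq_real _ B hB]
  refine eq_of_forall_dist_le fun ε hε => ?_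
  -- compare with a polynomial that is close on `[0, ‖B‖]`, which contains the spectrum and `ν`
  obtain ⟨δ, hδ, hδε⟩ : ∃ δ : ℝ, 0 < δ ∧ 2 * δ * ‖q‖ ≤ ε := by
    refine ⟨ε / (2 * (‖q‖ + 1)), by positivity, ?_⟩
    rw [show 2 * (ε / (2 * (‖q‖ + 1))) * ‖q‖ = ε * (‖q‖ / (‖q‖ + 1)) by field_simp]
    exact mul_le_of_le_one_right hε.le ((div_le_one (by positivity)).2 (by linarith))
  obtain ⟨p, hp⟩ := exists_polynomial_near_of_continuousOn 0 ‖B‖ _ hcont.continuousOn δ hδ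
  have hspec : ∀ x ∈ spectrum ℝ B, x ∈ Set.Icc 0 ‖B‖ := fun x hx =>
    ⟨spectrum_nonneg_of_nonneg hB hx, (le_abs_self x).trans (spectrum.norm_le_norm_of_mem hx)⟩
  have h1 : ‖cfc (fun x : ℝ => ((x.toNNReal ^ τ : NNReal) : ℝ)) B - Polynomial.aeval B p‖ ≤ δ := by
    rw [← cfc_polynomial p B hsa, ← cfc_sub _ _ B hcont.continuousOn p.continuous.continuousOn]
    refine norm_cfc_le hδ.le fun x hx => ?_
    rw [Real.norm_eq_abs, abs_sub_comm]
    exact (hp x (hspec x hx)).le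
  have h2 := (hp ν ⟨hν, hνB⟩).le
  rw [hνs] at h2
  rw [dist_eq_norm, ← sub_add_sub_cancel _ ((Polynomial.aeval B p) q)]
  refine (norm_add_le _ _).trans (le_trans (add_le_add (b := δ * ‖q‖) (d := δ * ‖q‖) ?_ ?_)
    (le_trans (by linarith) hδε))
  · rw [← sub_apply]
    exact (ContinuousLinearMap.le_opNorm _ _).trans (by gcongr)
  · rw [hpoly, ← sub_smul, norm_smul, ← Complex.ofReal_sub, Complex.norm_real]
    gcongr
    exact h2

/-! ### The energy space -/

namespace PosDefOperator

variable {H : Type*} [NormedAddCommGroup H] [InnerProductSpace ℂ H] [CompleteSpace H]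

theorem inner_inv (A : PosDefOperator H) (x y : H) :
    inner ℂ (A.inv x) y = inner ℂ x (A.inv y) :=
  ((ContinuousLinearMap.nonneg_iff_isPositive _).1 A.inv_nonneg).isSymmetric x y

theorem inner_inv_rpow (A : PosDefOperator H) (τ : ℝ) (x y : H) :
    inner ℂ ((A.inv ^ τ : H →L[ℂ] H) x) y = inner ℂ x ((A.inv ^ τ : H →L[ℂ] H) y) :=
  ((ContinuousLinearMap.nonneg_iff_isPositive _).1 CFC.rpow_nonneg).isSymmetric x y

namespace EnergySpace

theorem inner_def (A : PosDefOperator H) (u v : A.EnergySpace) :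
    inner ℂ u v = inner ℂ (half A u) (half A v) := rfl

theorem norm_half (A : PosDefOperator H) (u : A.EnergySpace) : ‖half A u‖ = ‖u‖ := by
  rw [norm_eq_sqrt_re_inner (𝕜 := ℂ), norm_eq_sqrt_re_inner (𝕜 := ℂ), inner_def]

theorem incl_injective (A : PosDefOperator H) : Function.Injective (incl A) :=
  Subtype.val_injective

theorem half_surjective (A : PosDefOperator H) : Function.Surjective (half A) := by
  intro y
  let z : A.EnergySpace := ⟨_, (A.mem_rpow_domain _ _).2 ⟨y, rfl⟩⟩
  exact ⟨z, A.inv_half_injective (inv_half_half z)⟩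

instance (A : PosDefOperator H) : CompleteSpace A.EnergySpace := by
  let e : A.EnergySpace ≃ₗᵢ[ℂ] H :=
    LinearIsometryEquiv.ofSurjective ⟨half A, norm_half A⟩ (half_surjective A)
  exact e.toIsometryEquiv.isometry.isUniformInducing.completeSpace_congr
    e.surjective |>.2 inferInstance

/-- The inclusion of `H_{1/2}` in `H`, as a bounded operator. -/
noncomputable def inclL (A : PosDefOperator H) : A.EnergySpace →L[ℂ] H :=
  (incl A).mkContinuous ‖(A.inv ^ (1 / 2 : ℝ) : H →L[ℂ] H)‖ fun u => by
    rw [← inv_half_half, ← norm_half]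
    exact ContinuousLinearMap.le_opNorm _ _

@[simp] theorem inclL_apply (A : PosDefOperator H) (u : A.EnergySpace) :
    inclL A u = incl A u := rfl

@[simp] theorem incl_ofDomain (A : PosDefOperator H) (x : A.domain) :
    incl A (ofDomain A x) = x := rfl

theorem half_ofDomain (A : PosDefOperator H) (x : A.domain) :
    half A (ofDomain A x) = (A.inv ^ (1 / 2 : ℝ) : H →L[ℂ] H) (A.app x) := by
  apply A.inv_half_injective
  rw [inv_half_half, A.inv_half_mul, A.inv_app, incl_ofDomain]

/-- The weak form of `A`: `⟪x, z⟫_{1/2} = ⟪A x, z⟫₀` for `x ∈ D(A)`. -/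
theorem inner_ofDomain (A : PosDefOperator H) (x : A.domain) (z : A.EnergySpace) :
    inner ℂ (ofDomain A x) z = inner ℂ (A.app x) (incl A z) := by
  rw [inner_def, half_ofDomain, inner_inv_rpow, inv_half_half]

end EnergySpace

/-- The weak solution operator: `A⁻¹ f`, as an element of `H_{1/2}`. -/
noncomputable def solve (A : PosDefOperator H) (f : H) : A.EnergySpace :=
  EnergySpace.ofDomain A ⟨A.inv f, A.inv_mem f⟩

theorem inner_solve (A : PosDefOperator H) (f : H) (z : A.EnergySpace) :
    inner ℂ (A.solve f) z = inner ℂ f (EnergySpace.incl A z) := by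
  rw [solve, EnergySpace.inner_ofDomain, A.app_inv]

/-! ### Complete listings of the eigenvalues -/

namespace IsEigenListing

variable {A : PosDefOperator H} {lam : ℕ → ℝ} {u : ℕ → H}

theorem pos (h : A.IsEigenListing lam u) (k : ℕ) : 0 < lam k := by
  obtain ⟨α, hα, hb⟩ := A.posDef
  have h1 := hb ⟨u k, h.mem k⟩
  have h2 : A.op ⟨u k, h.mem k⟩ = (lam k : ℂ) • u k := h.eigen k
  rw [h2, inner_smul_left, inner_self_eq_norm_sq_to_K, h.orthonormal.1 k] at h1
  simp at h1
  linarith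

theorem inv_apply (h : A.IsEigenListing lam u) (k : ℕ) :
    A.inv (u k) = ((lam k)⁻¹ : ℂ) • u k := by
  have h1 := A.inv_app ⟨u k, h.mem k⟩
  rw [h.eigen, map_smul] at h1
  have h2 : (lam k : ℂ) ≠ 0 := Complex.ofReal_ne_zero.2 (h.pos k).ne'
  exact (inv_smul_eq_iff₀ h2).2 h1.symm |>.symm

theorem span_dense (h : A.IsEigenListing lam u) (hA : IsCompactOperator A.inv) :
    (Submodule.span ℂ (Set.range u))ᗮ = ⊥ := by
  have hsymm : A.inv.IsSymmetric := fun x y => A.inner_inv x y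
  rw [eq_bot_iff, ← ContinuousLinearMap.orthogonalComplement_iSup_eigenspaces_eq_bot hA hsymm]
  refine Submodule.orthogonal_le (iSup_le fun ν x hx => ?_)
  rw [Module.End.mem_eigenspace_iff] at hx
  change A.inv x = ν • x at hx
  rcases eq_or_ne x 0 with rfl | hx0
  · exact zero_mem _
  have hev : Module.End.HasEigenvalue (A.inv : Module.End ℂ H) ν :=
    Module.End.hasEigenvalue_of_hasEigenvector ⟨Module.End.mem_eigenspace_iff.2 hx, hx0⟩
  have hreal : ((ν.re : ℝ) : ℂ) = ν :=
    Complex.conj_eq_iff_re.1 (LinearMap.IsSymmetric.conj_eigenvalue_eq_self hsymm hev)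
  have hν : ν ≠ 0 := by
    rintro rfl
    rw [zero_smul] at hx
    exact hx0 (A.inv_injective (hx.trans (map_zero _).symm))
  have hx1 : A.inv (ν⁻¹ • x) = x := by rw [map_smul, hx, inv_smul_smul₀ hν]
  have hxm : x ∈ A.domain := by rw [← hx1]; exact A.inv_mem _
  have happ : A.app ⟨x, hxm⟩ = ((ν.re⁻¹ : ℝ) : ℂ) • x := by
    apply A.inv_injective
    rw [A.inv_app, Complex.ofReal_inv, hreal, hx1]
  exact Submodule.span_mono (Set.image_subset_range _ _) (h.complete _ ⟨x, hxm⟩ happ)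

/-- The Hilbert basis of the eigenvectors of an operator with compact inverse. -/
noncomputable def hilbertBasis (h : A.IsEigenListing lam u) (hA : IsCompactOperator A.inv) :
    HilbertBasis ℕ ℂ H :=
  HilbertBasis.mkOfOrthogonalEqBot h.orthonormal (h.span_dense hA)

theorem coe_hilbertBasis (h : A.IsEigenListing lam u) (hA : IsCompactOperator A.inv) :
    ⇑(h.hilbertBasis hA) = u := HilbertBasis.coe_mkOfOrthogonalEqBot _ _

/-- The eigenvalues tend to infinity: otherwise the vectors `A⁻¹ u k` would keep a positive
distance from each other. -/
theorem tendsto_atTop (h : A.IsEigenListing lam u) (hA : IsCompactOperator A.inv) :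
    Filter.Tendsto lam Filter.atTop Filter.atTop := by
  rw [Filter.tendsto_atTop_atTop_iff_of_monotone h.monotone]
  by_contra! hb
  obtain ⟨L, hL⟩ := hb
  have hcomp := hA.isCompact_closure_image_of_bounded (f := (A.inv : H →ₗ[ℂ] H))
    (S := Set.range u) (isBounded_iff_forall_norm_le.2 ⟨1, by
      rintro _ ⟨k, rfl⟩; exact (h.orthonormal.1 k).le⟩)
  obtain ⟨a, -, φ, hφ, hlim⟩ := hcomp.tendsto_subseq (x := fun k => A.inv (u k))
    fun k => subset_closure ⟨u k, ⟨k, rfl⟩, rfl⟩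
  have hL0 : 0 < L := (h.pos 0).trans (hL 0)
  have hcau := hlim.cauchySeq
  obtain ⟨N, hN⟩ := Metric.cauchySeq_iff.1 hcau L⁻¹ (inv_pos.2 hL0)
  have hd := hN (N + 1) (by simp) N le_rfl
  have hne : φ (N + 1) ≠ φ N := (hφ (Nat.lt_succ_self N)).ne'
  simp only [Function.comp_apply, dist_eq_norm, h.inv_apply] at hd
  refine absurd hd (not_lt.2 ?_)
  refine le_trans (inv_anti₀ (h.pos (φ (N+1))) (hL _).le) ?_
  have hin : inner ℂ (u (φ (N + 1))) (((lam (φ (N + 1)))⁻¹ : ℂ) • u (φ (N + 1)) -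
      ((lam (φ N))⁻¹ : ℂ) • u (φ N)) = ((lam (φ (N + 1)))⁻¹ : ℂ) := by
    rw [inner_sub_right, inner_smul_right, inner_smul_right, h.orthonormal.2 hne,
      inner_self_eq_norm_sq_to_K, h.orthonormal.1]
    simp
  have h3 := norm_inner_le_norm (𝕜 := ℂ) (u (φ (N + 1))) (((lam (φ (N + 1)))⁻¹ : ℂ) • u (φ (N + 1)) -
      ((lam (φ N))⁻¹ : ℂ) • u (φ N))
  rw [hin, h.orthonormal.1, one_mul, norm_inv, Complex.norm_real,
    Real.norm_of_nonneg (h.pos _).le] at h3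
  exact h3

/-- `M^{-τ}` multiplies the `k`-th Fourier coefficient by `μ k ^ (-τ)`. -/
theorem inner_inv_rpow (h : A.IsEigenListing lam u) {τ : ℝ} (hτ : 0 ≤ τ) (k : ℕ) (x : H) :
    inner ℂ (u k) ((A.inv ^ τ : H →L[ℂ] H) x) = ((lam k ^ (-τ) : ℝ) : ℂ) * inner ℂ (u k) x := by
  have h1 := rpow_apply_eigenvector A.inv A.inv_nonneg (q := u k) (ν := (lam k)⁻¹)
    (_root_.inv_nonneg.2 (h.pos k).le) (by rw [h.inv_apply, Complex.ofReal_inv]) hτ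
  rw [← A.inner_inv_rpow, h1, inner_smul_left, Complex.conj_ofReal,
    Real.inv_rpow (h.pos k).le, Real.rpow_neg (h.pos k).le]

end IsEigenListing

end PosDefOperator

/-! ### Comparison of the energy norms and approximation by the eigenvectors of `M` -/

namespace PosDefOperator

open Filter Topology

section Comparison

variable {H : Type*} [NormedAddCommGroup H] [InnerProductSpace ℂ H] [CompleteSpace H]
  {G : Type*} [NormedAddCommGroup G] [InnerProductSpace ℂ G] [CompleteSpace G]

/-- If `‖A J v‖ ≤ C ‖M v‖` on `D(M)`, then also the quadratic form of `A` is dominated by that of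
`M`. The operator `J* A J M⁻¹` is bounded on `G`, and symmetric for `⟪M⁻¹ x, y⟫`. -/
theorem exists_energy_le (J : G ≃L[ℂ] H) (A : PosDefOperator H) (M : PosDefOperator G)
    (hD : ∀ x : G, x ∈ M.domain → J x ∈ A.domain)
    {C : ℝ} (hC : 0 < C) (hnorm : ∀ (x : G) (hx : x ∈ M.domain),
      ‖A.app ⟨J x, hD x hx⟩‖ ≤ C * ‖M.app ⟨x, hx⟩‖) :
    ∃ K : ℝ, 0 < K ∧ ∀ (v : G) (hv : v ∈ M.domain),
      ‖EnergySpace.ofDomain A ⟨J v, hD v hv⟩‖ ^ 2 ≤ K * (inner ℂ (M.app ⟨v, hv⟩) v).re := by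
  let J' : G →L[ℂ] H := J
  let T : G → H := fun x => A.app ⟨J (M.inv x), hD _ (M.inv_mem x)⟩
  let D : G →L[ℂ] G := M.inv ^ (1 / 2 : ℝ)
  let S : G → G := fun x => J'.adjoint (T x)
  have hT : ∀ x, ‖T x‖ ≤ C * ‖x‖ := fun x => by
    have h1 := hnorm _ (M.inv_mem x)
    rwa [M.app_inv] at h1
  have hDD : ∀ x y, inner ℂ (D x) (D y) = inner ℂ x (M.inv y) := fun x y => by
    rw [M.inner_inv_rpow, M.inv_half_mul]
  have hSinner : ∀ x y, inner ℂ (D (S x)) (D y) = inner ℂ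
      (EnergySpace.ofDomain A ⟨J (M.inv x), hD _ (M.inv_mem x)⟩)
      (EnergySpace.ofDomain A ⟨J (M.inv y), hD _ (M.inv_mem y)⟩) := fun x y => by
    rw [EnergySpace.inner_ofDomain, hDD, ContinuousLinearMap.adjoint_inner_left]
    rfl
  have hsymm : ∀ x y, inner ℂ (D (S x)) (D y) = inner ℂ (D x) (D (S y)) := fun x y => by
    rw [← inner_conj_symm (D x), hSinner, hSinner, inner_conj_symm]
  set K : ℝ := (‖J'.adjoint‖ + 1) * C with hK
  have hK0 : 0 < K := by positivity
  have hSK : ∀ x, ‖S x‖ ≤ K * ‖x‖ := fun x =>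
    calc ‖S x‖ ≤ ‖J'.adjoint‖ * ‖T x‖ := ContinuousLinearMap.le_opNorm _ _
      _ ≤ (‖J'.adjoint‖ + 1) * (C * ‖x‖) := by gcongr; exacts [by linarith, hT x]
      _ = _ := by rw [hK]; ring
  refine ⟨K, hK0, fun v hv => ?_⟩
  have key := norm_map_le_of_symmetrizable D S hK0 hSK hsymm (M.app ⟨v, hv⟩)
  have hv' : M.inv (M.app ⟨v, hv⟩) = v := M.inv_app _
  have h1 := hSinner (M.app ⟨v, hv⟩) (M.app ⟨v, hv⟩)
  have h2 := hDD (M.app ⟨v, hv⟩) (M.app ⟨v, hv⟩)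
  simp only [hv'] at h1 h2
  rw [← h2, ← RCLike.re_eq_complex_re, inner_self_eq_norm_sq]
  have h3 : ‖EnergySpace.ofDomain A ⟨J v, hD v hv⟩‖ ^ 2 ≤
      ‖D (S (M.app ⟨v, hv⟩))‖ * ‖D (M.app ⟨v, hv⟩)‖ := by
    rw [← inner_self_eq_norm_sq (𝕜 := ℂ), ← h1]
    exact (RCLike.re_le_norm _).trans (norm_inner_le_norm _ _)
  nlinarith [norm_nonneg (D (M.app ⟨v, hv⟩))]

variable {J : G ≃L[ℂ] H} {A : PosDefOperator H} {M : PosDefOperator G} {μ : ℕ → ℝ} {q : ℕ → G}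

/-- The energy of a finite combination of the eigenvectors of `M`. -/
theorem norm_sum_sq_le (hq : M.IsEigenListing μ q) (hD : ∀ x : G, x ∈ M.domain → J x ∈ A.domain)
    {K : ℝ} (hK : ∀ (v : G) (hv : v ∈ M.domain),
      ‖EnergySpace.ofDomain A ⟨J v, hD v hv⟩‖ ^ 2 ≤ K * (inner ℂ (M.app ⟨v, hv⟩) v).re)
    (F : Finset ℕ) (c : ℕ → ℂ) :
    ‖∑ k ∈ F, c k • EnergySpace.ofDomain A ⟨J (q k), hD _ (hq.mem k)⟩‖ ^ 2 ≤
      K * ∑ k ∈ F, μ k * ‖c k‖ ^ 2 := by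
  have hmem : ∑ k ∈ F, c k • q k ∈ M.domain :=
    Submodule.sum_mem _ fun k _ => Submodule.smul_mem _ _ (hq.mem k)
  have h1 : ∑ k ∈ F, c k • EnergySpace.ofDomain A ⟨J (q k), hD _ (hq.mem k)⟩ =
      EnergySpace.ofDomain A ⟨J (∑ k ∈ F, c k • q k), hD _ hmem⟩ := by
    apply EnergySpace.incl_injective
    simp
  have h2 : M.app ⟨∑ k ∈ F, c k • q k, hmem⟩ = ∑ k ∈ F, (μ k * c k : ℂ) • q k := by
    have : (⟨∑ k ∈ F, c k • q k, hmem⟩ : M.domain) =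
        ∑ k ∈ F, c k • (⟨q k, hq.mem k⟩ : M.domain) := by
      apply Subtype.ext; simp
    rw [this, app]
    refine (map_sum M.op.toFun _ _).trans (Finset.sum_congr rfl fun k _ => ?_)
    rw [mul_comm, mul_smul, ← hq.eigen k]
    exact M.op.map_smul (c k) ⟨q k, hq.mem k⟩
  have h3 : (inner ℂ (M.app ⟨∑ k ∈ F, c k • q k, hmem⟩) (∑ k ∈ F, c k • q k)).re =
      ∑ k ∈ F, μ k * ‖c k‖ ^ 2 := by
    rw [h2, hq.orthonormal.inner_sum, Complex.re_sum]
    refine Finset.sum_congr rfl fun k _ => ?_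
    rw [map_mul, Complex.conj_ofReal, mul_assoc, Complex.conj_mul', ← Complex.ofReal_pow,
      ← Complex.ofReal_mul, Complex.ofReal_re]
  rw [h1, ← h3]
  exact hK _ hmem

/-- Elements with Fourier coefficients `μ k ^ (-τ) * ⟪q k, x⟫`, `τ ≥ 1/2`, have finite energy, and
the energy error of the Galerkin projection is controlled by the tail of the coefficients of `x`. -/
theorem exists_energy_error_le (hq : M.IsEigenListing μ q) (hM : IsCompactOperator M.inv)
    (hD : ∀ x : G, x ∈ M.domain → J x ∈ A.domain)
    {K : ℝ} (hK0 : 0 < K) (hK : ∀ (v : G) (hv : v ∈ M.domain),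
      ‖EnergySpace.ofDomain A ⟨J v, hD v hv⟩‖ ^ 2 ≤ K * (inner ℂ (M.app ⟨v, hv⟩) v).re)
    {w : ℕ → A.EnergySpace} (hw : ∀ k, w k = EnergySpace.ofDomain A ⟨J (q k), hD _ (hq.mem k)⟩)
    {τ : ℝ} (hτ : 1 / 2 ≤ τ) {x v : G}
    (hv : ∀ k, inner ℂ (q k) v = ((μ k ^ (-τ) : ℝ) : ℂ) * inner ℂ (q k) x) :
    ∃ v' : A.EnergySpace, EnergySpace.incl A v' = J v ∧ ∀ n,
      ‖v' - A.energyProj w n v'‖ ^ 2 ≤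
        K * (μ n ^ (1 - 2 * τ) * ∑' k, ‖inner ℂ (q (k + n)) x‖ ^ 2) := by
  set a : ℕ → ℝ := fun k => ‖inner ℂ (q k) x‖ ^ 2 with ha
  have hsum : Summable a := hq.orthonormal.inner_products_summable x
  set t : ℕ → ℝ := fun n => ∑' k, a (k + n) with ht
  have ht0 : Tendsto t atTop (𝓝 0) := tendsto_sum_nat_add a
  set B : ℕ → ℝ := fun n => K * (μ n ^ (1 - 2 * τ) * t n) with hB
  have htnn : ∀ n, 0 ≤ t n := fun n => tsum_nonneg fun k => by positivity
  have hμnn : ∀ n, 0 ≤ μ n ^ (1 - 2 * τ) := fun n => Real.rpow_nonneg (hq.pos n).le _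
  have hμle : ∀ {m n}, m ≤ n → μ n ^ (1 - 2 * τ) ≤ μ m ^ (1 - 2 * τ) := fun {m n} hmn =>
    Real.rpow_le_rpow_of_nonpos (hq.pos m) (hq.monotone hmn) (by linarith)
  have hBnn : ∀ n, 0 ≤ B n := fun n => mul_nonneg hK0.le (mul_nonneg (hμnn n) (htnn n))
  have hB0 : Tendsto B atTop (𝓝 0) := by
    refine squeeze_zero hBnn (g := fun n => K * (μ 0 ^ (1 - 2 * τ) * t n)) (fun n => ?_) ?_
    · exact mul_le_mul_of_nonneg_left
        (mul_le_mul_of_nonneg_right (hμle (Nat.zero_le n)) (htnn n)) hK0.le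
    · simpa using (ht0.const_mul (μ 0 ^ (1 - 2 * τ))).const_mul K
  -- the partial sums of the expansion of `v` are Cauchy in the energy space
  set s : ℕ → A.EnergySpace := fun n => ∑ k ∈ Finset.range n, inner ℂ (q k) v • w k with hs
  have hdiff : ∀ {n m}, n ≤ m → ‖s m - s n‖ ^ 2 ≤ B n := by
    intro n m hnm
    rw [hs]
    simp only
    rw [← Finset.sum_Ico_eq_sub _ hnm]
    simp only [hw]
    refine (norm_sum_sq_le hq hD hK _ _).trans (mul_le_mul_of_nonneg_left ?_ hK0.le)
    calc ∑ k ∈ Finset.Ico n m, μ k * ‖inner ℂ (q k) v‖ ^ 2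
        = ∑ k ∈ Finset.Ico n m, μ k ^ (1 - 2 * τ) * a k := by
          refine Finset.sum_congr rfl fun k _ => ?_
          have hk := hq.pos k
          rw [hv, norm_mul, Complex.norm_real, Real.norm_of_nonneg (Real.rpow_nonneg hk.le _),
            mul_pow, ← mul_assoc, ← Real.rpow_natCast, ← Real.rpow_mul hk.le,
            show 1 - 2 * τ = 1 + -τ * (2 : ℕ) by push_cast; ring, Real.rpow_add hk, Real.rpow_one]
      _ ≤ ∑ k ∈ Finset.Ico n m, μ n ^ (1 - 2 * τ) * a k := by
          refine Finset.sum_le_sum fun k hk => mul_le_mul_of_nonneg_right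
            (hμle (Finset.mem_Ico.1 hk).1) (by positivity)
      _ = μ n ^ (1 - 2 * τ) * ∑ k ∈ Finset.range (m - n), a (k + n) := by
          rw [← Finset.mul_sum, Finset.sum_Ico_eq_sum_range]
          simp only [add_comm]
      _ ≤ _ := mul_le_mul_of_nonneg_left
          (Summable.sum_le_tsum _ (fun k _ => by positivity) ((summable_nat_add_iff n).2 hsum))
          (hμnn n)
  have hcau : CauchySeq s := by
    refine cauchySeq_of_le_tendsto_0' (fun n => √(B n)) (fun n m hnm => ?_) ?_
    · rw [dist_comm, dist_eq_norm]
      exact Real.le_sqrt_of_sq_le (hdiff hnm)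
    · simpa using hB0.sqrt
  obtain ⟨v', hv'⟩ := cauchySeq_tendsto_of_complete hcau
  refine ⟨v', ?_, fun n => ?_⟩
  · have h1 : Tendsto (fun n => EnergySpace.inclL A (s n)) atTop (𝓝 (EnergySpace.inclL A v')) :=
      ((EnergySpace.inclL A).continuous.tendsto _).comp hv'
    have h2 : ∀ n, EnergySpace.inclL A (s n) =
        J (∑ k ∈ Finset.range n, inner ℂ (q k) v • q k) := fun n => by
      simp [hs, hw]
    have h3 := ((hq.hilbertBasis hM).hasSum_repr v).tendsto_sum_nat
    simp only [HilbertBasis.repr_apply_apply, hq.coe_hilbertBasis] at h3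
    simp only [h2] at h1
    exact tendsto_nhds_unique h1 ((J.continuous.tendsto v).comp h3)
  · have hsn : s n ∈ A.trialSpace w n :=
      Submodule.sum_mem _ fun k hk => Submodule.smul_mem _ _
        (Submodule.subset_span ⟨⟨k, Finset.mem_range.1 hk⟩, rfl⟩)
    have h1 : ‖v' - A.energyProj w n v'‖ ≤ ‖v' - s n‖ := by
      rw [energyProj, Submodule.starProjection_minimal]
      exact ciInf_le ⟨0, by rintro _ ⟨y, rfl⟩; exact norm_nonneg _⟩ (⟨s n, hsn⟩ : A.trialSpace w n)
    refine (pow_le_pow_left₀ (norm_nonneg _) h1 2).trans ?_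
    exact le_of_tendsto ((hv'.sub_const (s n)).norm.pow 2)
      (eventually_atTop.2 ⟨n, fun m hm => hdiff hm⟩)

/-- Galerkin approximation of the solutions of `A φ = f`. -/
theorem exists_solve_error_le (hq : M.IsEigenListing μ q) (hM : IsCompactOperator M.inv)
    (hD : ∀ x : G, x ∈ M.domain ↔ J x ∈ A.domain)
    {c : ℝ} (hc : 0 < c) (hnorm : ∀ (x : G) (hx : x ∈ M.domain),
      c * ‖M.app ⟨x, hx⟩‖ ≤ ‖A.app ⟨J x, (hD x).1 hx⟩‖)
    {K : ℝ} (hK0 : 0 < K) (hK : ∀ (v : G) (hv : v ∈ M.domain),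
      ‖EnergySpace.ofDomain A ⟨J v, (hD v).1 hv⟩‖ ^ 2 ≤ K * (inner ℂ (M.app ⟨v, hv⟩) v).re)
    {w : ℕ → A.EnergySpace}
    (hw : ∀ k, w k = EnergySpace.ofDomain A ⟨J (q k), (hD _).1 (hq.mem k)⟩) :
    ∃ C : ℝ, 0 < C ∧ ∀ (n : ℕ) (f : H),
      ‖A.solve f - A.energyProj w n (A.solve f)‖ ≤ C * μ n ^ (-(1 / 2) : ℝ) * ‖f‖ := by
  refine ⟨√K / c, by positivity, fun n f => ?_⟩
  have hvm : J.symm (A.inv f) ∈ M.domain := by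
    rw [hD, J.apply_symm_apply]; exact A.inv_mem f
  set x : G := M.app ⟨J.symm (A.inv f), hvm⟩ with hx
  have hxf : c * ‖x‖ ≤ ‖f‖ := by
    have h1 := hnorm _ hvm
    have h2 : A.app ⟨J (J.symm (A.inv f)), (hD _).1 hvm⟩ = f :=
      (congrArg A.app (Subtype.ext (J.apply_symm_apply _))).trans (A.app_inv f)
    rwa [h2] at h1
  have hcoef : ∀ k, inner ℂ (q k) (J.symm (A.inv f)) =
      ((μ k ^ (-1 : ℝ) : ℝ) : ℂ) * inner ℂ (q k) x := fun k => by
    have h1 : M.inv x = J.symm (A.inv f) := M.inv_app _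
    rw [← h1, ← M.inner_inv, hq.inv_apply, inner_smul_left, Real.rpow_neg_one]
    simp
  obtain ⟨v', hv', herr⟩ := exists_energy_error_le hq hM (fun x hx => (hD x).1 hx) hK0 hK hw
    (τ := 1) (by norm_num) hcoef
  have hv's : v' = A.solve f := by
    apply EnergySpace.incl_injective
    rw [hv', J.apply_symm_apply]
    rfl
  rw [← hv's]
  refine abs_le_of_sq_le_sq' ?_ ?_ |>.2
  · refine (herr n).trans ?_
    have hxs := hq.orthonormal.inner_products_summable x
    have htail : ∑' k, ‖inner ℂ (q (k + n)) x‖ ^ 2 ≤ ‖x‖ ^ 2 := by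
      refine le_trans ?_ (hq.orthonormal.tsum_inner_products_le x)
      rw [← hxs.sum_add_tsum_nat_add n]
      exact le_add_of_nonneg_left (Finset.sum_nonneg fun k _ => by positivity)
    have hμ : (μ n ^ (-(1 / 2) : ℝ)) ^ 2 = μ n ^ (1 - 2 * 1 : ℝ) := by
      rw [← Real.rpow_natCast, ← Real.rpow_mul (hq.pos n).le]; norm_num
    have hx2 : ‖x‖ ≤ ‖f‖ / c := by rw [le_div_iff₀ hc]; linarith
    calc K * (μ n ^ (1 - 2 * 1 : ℝ) * ∑' k, ‖inner ℂ (q (k + n)) x‖ ^ 2)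
        ≤ K * (μ n ^ (1 - 2 * 1 : ℝ) * (‖f‖ / c) ^ 2) := by
          have := Real.rpow_nonneg (hq.pos n).le (1 - 2 * 1 : ℝ)
          gcongr
          exact htail.trans (by gcongr)
      _ = _ := by rw [mul_pow, mul_pow, hμ, div_pow, div_pow, Real.sq_sqrt hK0.le]; ring
  · have := Real.rpow_nonneg (hq.pos n).le (-(1 / 2) : ℝ)
    positivity

/-- For `v ∈ D(M^σ)` the energy error of the Galerkin projection is `o(μ n ^ (1/2 - σ))`. -/
theorem exists_energy_error_isLittleO (hq : M.IsEigenListing μ q) (hM : IsCompactOperator M.inv)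
    (hD : ∀ x : G, x ∈ M.domain → J x ∈ A.domain)
    {K : ℝ} (hK0 : 0 < K) (hK : ∀ (v : G) (hv : v ∈ M.domain),
      ‖EnergySpace.ofDomain A ⟨J v, hD v hv⟩‖ ^ 2 ≤ K * (inner ℂ (M.app ⟨v, hv⟩) v).re)
    {w : ℕ → A.EnergySpace} (hw : ∀ k, w k = EnergySpace.ofDomain A ⟨J (q k), hD _ (hq.mem k)⟩)
    {σ : ℝ} (hσ : 1 / 2 ≤ σ) {v : G} (hv : v ∈ (M.rpow σ).domain) :
    ∃ v' : A.EnergySpace, EnergySpace.incl A v' = J v ∧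
      (fun n => ‖v' - A.energyProj w n v'‖) =o[atTop] fun n => μ n ^ (1 / 2 - σ) := by
  obtain ⟨x, hx⟩ := (M.mem_rpow_domain _ _).1 hv
  obtain ⟨v', hv', herr⟩ := exists_energy_error_le hq hM hD hK0 hK hw hσ (x := x) (v := v)
    fun k => by rw [← hx, hq.inner_inv_rpow (by linarith)]
  refine ⟨v', hv', ?_⟩
  refine Asymptotics.IsLittleO.of_pow (n := 2) ?_ two_ne_zero
  have ht0 : Tendsto (fun n => ∑' k, ‖inner ℂ (q (k + n)) x‖ ^ 2) atTop (𝓝 0) :=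
    tendsto_sum_nat_add fun k => ‖inner ℂ (q k) x‖ ^ 2
  have h1 : (fun n => K * (μ n ^ (1 - 2 * σ) * ∑' k, ‖inner ℂ (q (k + n)) x‖ ^ 2)) =o[atTop]
      fun n => μ n ^ (1 - 2 * σ) := by
    refine Asymptotics.IsLittleO.const_mul_left ?_ K
    simpa using (Asymptotics.isBigO_refl (fun n => μ n ^ (1 - 2 * σ)) atTop).mul_isLittleO
      ((Asymptotics.isLittleO_one_iff ℝ).2 ht0)
  have h2 : ((fun n => μ n ^ (1 / 2 - σ)) ^ 2 : ℕ → ℝ) = fun n => μ n ^ (1 - 2 * σ) := by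
    ext n
    rw [Pi.pow_apply, ← Real.rpow_natCast, ← Real.rpow_mul (hq.pos n).le]
    push_cast; ring_nf
  rw [h2]
  refine Asymptotics.IsBigO.trans_isLittleO (Asymptotics.IsBigO.of_bound 1 ?_) h1
  refine Eventually.of_forall fun n => ?_
  rw [one_mul, Pi.pow_apply, Real.norm_of_nonneg (by positivity)]
  exact (herr n).trans (le_abs_self _)

end Comparison

section Duality

variable {H : Type*} [NormedAddCommGroup H] [InnerProductSpace ℂ H] [CompleteSpace H]
  {A : PosDefOperator H} {w : ℕ → A.EnergySpace}

/-- The duality argument of Aubin and Nitsche. -/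
theorem norm_incl_error_le {n : ℕ} {κ : ℝ} (hκ0 : 0 ≤ κ)
    (hκ : ∀ f : H, ‖A.solve f - A.energyProj w n (A.solve f)‖ ≤ κ * ‖f‖) (z : A.EnergySpace) :
    ‖EnergySpace.incl A (z - A.energyProj w n z)‖ ≤ κ * ‖z - A.energyProj w n z‖ := by
  set e := z - A.energyProj w n z with he
  set f := EnergySpace.incl A e with hf
  have hperp : ∀ y, inner ℂ (A.energyProj w n y) e = 0 := fun y =>
    (A.trialSpace w n).sub_starProjection_mem_orthogonal z _
      (Submodule.starProjection_apply_mem _ y)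
  have h1 : inner ℂ (A.solve f - A.energyProj w n (A.solve f)) e = inner ℂ f f := by
    rw [inner_sub_left, hperp, sub_zero, inner_solve]
  have h2 : ‖f‖ ^ 2 ≤ κ * ‖f‖ * ‖e‖ := by
    rw [← inner_self_eq_norm_sq (𝕜 := ℂ), ← h1]
    exact (RCLike.re_le_norm _).trans ((norm_inner_le_norm _ _).trans
      (mul_le_mul_of_nonneg_right (hκ f) (norm_nonneg _)))
  rcases (norm_nonneg f).eq_or_lt with h0 | h0
  · rw [← h0]; positivity
  · nlinarith

end Duality

end PosDefOperator

/-! ### Spectral inequalities in the energy space -/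

/-- A homogeneous system of `j` linear equations in `j + 1` unknowns has a normalized solution. -/
theorem exists_normalized_solution (m : ℕ → ℕ → ℂ) (j : ℕ) :
    ∃ a : ℕ → ℂ, ∑ i ∈ Finset.range (j + 1), ‖a i‖ ^ 2 = 1 ∧
      ∀ k < j, ∑ i ∈ Finset.range (j + 1), a i * m k i = 0 := by
  let T : EuclideanSpace ℂ (Fin (j + 1)) →ₗ[ℂ] (Fin j → ℂ) :=
    { toFun := fun b k => ∑ i, b i * m k i
      map_add' := fun b c => by ext k; simp [add_mul, Finset.sum_add_distrib]
      map_smul' := fun r b => by ext k; simp [Finset.mul_sum, mul_assoc] }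
  have hker : LinearMap.ker T ≠ ⊥ := LinearMap.ker_ne_bot_of_finrank_lt (by simp)
  obtain ⟨b, hb, hb0⟩ := Submodule.exists_mem_ne_zero_of_ne_bot hker
  have hn : ‖b‖ ≠ 0 := norm_ne_zero_iff.2 hb0
  set c : EuclideanSpace ℂ (Fin (j + 1)) := (‖b‖⁻¹ : ℂ) • b with hc
  have hcn : ‖c‖ = 1 := by rw [hc, norm_smul]; simp [hn]
  have hcT : T c = 0 := by rw [hc, map_smul, LinearMap.mem_ker.1 hb, smul_zero]
  refine ⟨fun i => if h : i < j + 1 then c ⟨i, h⟩ else 0, ?_, fun k hk => ?_⟩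
  · have h1 := EuclideanSpace.norm_sq_eq c
    rw [hcn, one_pow] at h1
    simp only [Finset.sum_range, Fin.is_lt, dite_true, Fin.eta]
    exact h1.symm
  · simp only [Finset.sum_range, Fin.is_lt, dite_true, Fin.eta]
    exact congrFun hcT ⟨k, hk⟩

namespace PosDefOperator

open EnergySpace

variable {H : Type*} [NormedAddCommGroup H] [InnerProductSpace ℂ H] [CompleteSpace H]
  {A : PosDefOperator H} {lam : ℕ → ℝ} {u : ℕ → H}

theorem inner_trial_error (A : PosDefOperator H) (w : ℕ → A.EnergySpace) (n : ℕ)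
    {y : A.EnergySpace} (hy : y ∈ A.trialSpace w n) (z : A.EnergySpace) :
    inner ℂ y (z - A.energyProj w n z) = 0 :=
  (A.trialSpace w n).sub_starProjection_mem_orthogonal z y hy

theorem energyProj_mem (A : PosDefOperator H) (w : ℕ → A.EnergySpace) (n : ℕ)
    (z : A.EnergySpace) : A.energyProj w n z ∈ A.trialSpace w n :=
  Submodule.starProjection_apply_mem _ z

namespace IsEigenListing

/-- The eigenvectors, as elements of the energy space. -/
noncomputable def energyVec (h : A.IsEigenListing lam u) (k : ℕ) : A.EnergySpace :=
  ofDomain A ⟨u k, h.mem k⟩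

@[simp] theorem incl_energyVec (h : A.IsEigenListing lam u) (k : ℕ) :
    incl A (h.energyVec k) = u k := rfl

theorem inner_energyVec (h : A.IsEigenListing lam u) (k : ℕ) (z : A.EnergySpace) :
    inner ℂ (h.energyVec k) z = (lam k : ℂ) * inner ℂ (u k) (incl A z) := by
  rw [energyVec, inner_ofDomain, h.eigen, inner_smul_left, Complex.conj_ofReal]

theorem norm_sq_sum_smul (h : A.IsEigenListing lam u) (F : Finset ℕ) (c : ℕ → ℂ) :
    ‖∑ k ∈ F, c k • u k‖ ^ 2 = ∑ k ∈ F, ‖c k‖ ^ 2 := by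
  rw [← inner_self_eq_norm_sq (𝕜 := ℂ), h.orthonormal.inner_sum, map_sum]
  refine Finset.sum_congr rfl fun k _ => ?_
  rw [Complex.conj_mul', ← Complex.ofReal_pow]
  exact Complex.ofReal_re _

theorem norm_sq_sum_energyVec (h : A.IsEigenListing lam u) (F : Finset ℕ) (c : ℕ → ℂ) :
    ‖∑ k ∈ F, c k • h.energyVec k‖ ^ 2 = ∑ k ∈ F, lam k * ‖c k‖ ^ 2 := by
  rw [← inner_self_eq_norm_sq (𝕜 := ℂ), sum_inner, map_sum]
  refine Finset.sum_congr rfl fun k hk => ?_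
  rw [inner_smul_left, inner_energyVec]
  simp only [map_sum, map_smul, incl_energyVec]
  rw [h.orthonormal.inner_right_sum _ hk, mul_left_comm, Complex.conj_mul', ← Complex.ofReal_pow,
    ← Complex.ofReal_mul]
  exact Complex.ofReal_re _

/-- The minimum principle: `lam K` is a lower bound of the Rayleigh quotient on the orthogonal
complement of the first `K` eigenvectors. -/
theorem mul_norm_sq_incl_le (h : A.IsEigenListing lam u) (hA : IsCompactOperator A.inv) {K : ℕ}
    {z : A.EnergySpace} (hz : ∀ k < K, inner ℂ (u k) (incl A z) = 0) :
    lam K * ‖incl A z‖ ^ 2 ≤ ‖z‖ ^ 2 := by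
  -- the normalized eigenvectors are orthonormal in the energy space
  have hon : Orthonormal ℂ fun k => ((√(lam k))⁻¹ : ℂ) • h.energyVec k := by
    have hs : ∀ k, (√(lam k) : ℂ) ≠ 0 := fun k =>
      Complex.ofReal_ne_zero.2 (Real.sqrt_pos.2 (h.pos k)).ne'
    rw [orthonormal_iff_ite]
    intro i k
    rw [inner_smul_left, inner_smul_right, inner_energyVec, incl_energyVec,
      orthonormal_iff_ite.1 h.orthonormal i k]
    split_ifs with hik
    · subst hik
      have h2 : (lam i : ℂ) = √(lam i) * √(lam i) := by
        rw [← Complex.ofReal_mul, Real.mul_self_sqrt (h.pos i).le]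
      rw [map_inv₀, Complex.conj_ofReal, h2]
      have := hs i
      field_simp
    · simp
  -- Bessel's inequality in the energy space is compared termwise with Parseval's identity in `H`
  have hE := hon.tsum_inner_products_le z
  have hEs := hon.inner_products_summable z
  have hterm : ∀ k, ‖inner ℂ (((√(lam k))⁻¹ : ℂ) • h.energyVec k) z‖ ^ 2 =
      lam k * ‖inner ℂ (u k) (incl A z)‖ ^ 2 := fun k => by
    have hk := h.pos k
    rw [inner_smul_left, inner_energyVec, norm_mul, norm_mul, RCLike.norm_conj, norm_inv,
      Complex.norm_real, Complex.norm_real, Real.norm_of_nonneg hk.le,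
      Real.norm_of_nonneg (Real.sqrt_nonneg _), mul_pow, mul_pow, inv_pow, Real.sq_sqrt hk.le]
    field_simp
  simp only [hterm] at hE hEs
  have hpars := (h.hilbertBasis hA).orthonormal.inner_products_summable (incl A z)
  have hP : ∑' k, ‖inner ℂ (u k) (incl A z)‖ ^ 2 = ‖incl A z‖ ^ 2 := by
    have h1 := (h.hilbertBasis hA).tsum_inner_mul_inner (incl A z) (incl A z)
    have h2 := (h.hilbertBasis hA).summable_inner_mul_inner (incl A z) (incl A z)
    rw [← inner_self_eq_norm_sq (𝕜 := ℂ), ← h1, RCLike.re_eq_complex_re, Complex.re_tsum h2]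
    refine tsum_congr fun k => ?_
    rw [h.coe_hilbertBasis, ← inner_conj_symm (incl A z), Complex.conj_mul', ← Complex.ofReal_pow,
      Complex.ofReal_re]
  rw [h.coe_hilbertBasis] at hpars
  refine le_trans ?_ hE
  rw [← hP, ← tsum_mul_left]
  refine (hpars.mul_left _).tsum_le_tsum (fun k => ?_) hEs
  rcases lt_or_ge k K with hk | hk
  · simp [hz k hk]
  · exact mul_le_mul_of_nonneg_right (h.monotone hk) (by positivity)

theorem norm_incl_le (h : A.IsEigenListing lam u) (hA : IsCompactOperator A.inv)
    (z : A.EnergySpace) : ‖incl A z‖ ≤ (√(lam 0))⁻¹ * ‖z‖ := by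
  have h1 := h.mul_norm_sq_incl_le hA (K := 0) (z := z) (by simp)
  have h0 := h.pos 0
  refine le_of_sq_le_sq ?_ (by positivity)
  rw [mul_pow, inv_pow, Real.sq_sqrt h0.le, ← div_eq_inv_mul, le_div_iff₀ h0]
  linarith

end IsEigenListing

/-! ### Rayleigh-Ritz systems -/

namespace IsRitzSystem

variable {w : ℕ → A.EnergySpace} {n : ℕ} {Λ : ℕ → ℝ} {U : ℕ → A.EnergySpace}

theorem mem (R : A.IsRitzSystem w n (fun j => Λ j) (fun j => U j)) {j : ℕ} (hj : j < n) :
    U j ∈ A.trialSpace w n := by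
  obtain ⟨x, hx, -⟩ := R.eigen ⟨j, hj⟩
  simp only at hx
  rw [hx]
  exact Submodule.sum_mem _ fun k _ => Submodule.smul_mem _ _ (Submodule.subset_span ⟨k, rfl⟩)

/-- The weak form of the matrix eigenvalue problem. -/
theorem inner_right (R : A.IsRitzSystem w n (fun j => Λ j) (fun j => U j)) {j : ℕ} (hj : j < n)
    {z : A.EnergySpace} (hz : z ∈ A.trialSpace w n) :
    inner ℂ z (U j) = (Λ j : ℂ) * inner ℂ (incl A z) (incl A (U j)) := by
  obtain ⟨x, hx, he⟩ := R.eigen ⟨j, hj⟩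
  simp only at hx he
  induction hz using Submodule.span_induction with
  | mem z hz =>
    obtain ⟨i, rfl⟩ := hz
    have h1 := congrFun he i
    simp only [Matrix.mulVec, dotProduct, Matrix.of_apply, Pi.smul_apply, smul_eq_mul] at h1
    rw [hx, inner_sum, map_sum, inner_sum]
    simp only [map_smul, inner_smul_right]
    simpa only [mul_comm (x _)] using h1
  | zero => simp
  | add y z _ _ hy hz => rw [inner_add_left, hy, hz, map_add, inner_add_left, mul_add]
  | smul c z _ hz => rw [inner_smul_left, hz, map_smul, inner_smul_left]; ring

theorem inner_left (R : A.IsRitzSystem w n (fun j => Λ j) (fun j => U j)) {j : ℕ} (hj : j < n)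
    {z : A.EnergySpace} (hz : z ∈ A.trialSpace w n) :
    inner ℂ (U j) z = (Λ j : ℂ) * inner ℂ (incl A (U j)) (incl A z) := by
  rw [← inner_conj_symm, R.inner_right hj hz, map_mul, Complex.conj_ofReal, inner_conj_symm]

theorem norm_sq (R : A.IsRitzSystem w n (fun j => Λ j) (fun j => U j)) {j : ℕ} (hj : j < n) :
    ‖U j‖ ^ 2 = Λ j := by
  have h1 := R.inner_left hj (R.mem hj)
  have h2 : ‖incl A (U j)‖ = 1 := R.orthonormal.1 ⟨j, hj⟩
  rw [inner_self_eq_norm_sq_to_K, inner_self_eq_norm_sq_to_K, h2] at h1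
  norm_num at h1
  exact_mod_cast h1

theorem inner_incl (R : A.IsRitzSystem w n (fun j => Λ j) (fun j => U j)) {i k : ℕ}
    (hi : i < n) (hk : k < n) :
    inner ℂ (incl A (U i)) (incl A (U k)) = if i = k then 1 else 0 := by
  have h1 := orthonormal_iff_ite.1 R.orthonormal ⟨i, hi⟩ ⟨k, hk⟩
  simpa using h1

theorem inner_incl_sum (R : A.IsRitzSystem w n (fun j => Λ j) (fun j => U j)) {F : Finset ℕ}
    (hF : ∀ m ∈ F, m < n) (c : ℕ → ℂ) {i : ℕ} (hi : i ∈ F) :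
    inner ℂ (incl A (U i)) (incl A (∑ m ∈ F, c m • U m)) = c i := by
  simp only [map_sum, map_smul, inner_sum, inner_smul_right]
  rw [Finset.sum_eq_single_of_mem i hi fun m hm hne => by
    rw [R.inner_incl (hF i hi) (hF m hm), if_neg hne.symm, mul_zero],
    R.inner_incl (hF i hi) (hF i hi), if_pos rfl, mul_one]

theorem norm_sq_incl_sum (R : A.IsRitzSystem w n (fun j => Λ j) (fun j => U j)) {F : Finset ℕ}
    (hF : ∀ m ∈ F, m < n) (c : ℕ → ℂ) :
    ‖incl A (∑ m ∈ F, c m • U m)‖ ^ 2 = ∑ m ∈ F, ‖c m‖ ^ 2 := by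
  rw [← inner_self_eq_norm_sq (𝕜 := ℂ)]
  conv_lhs => enter [2, 2]; rw [map_sum]
  rw [sum_inner, map_sum]
  refine Finset.sum_congr rfl fun k hk => ?_
  rw [map_smul, inner_smul_left, R.inner_incl_sum hF c hk, Complex.conj_mul', ← Complex.ofReal_pow]
  exact Complex.ofReal_re _

theorem norm_sq_sum (R : A.IsRitzSystem w n (fun j => Λ j) (fun j => U j)) {F : Finset ℕ}
    (hF : ∀ m ∈ F, m < n) (c : ℕ → ℂ) :
    ‖∑ m ∈ F, c m • U m‖ ^ 2 = ∑ m ∈ F, Λ m * ‖c m‖ ^ 2 := by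
  have hmem : ∑ m ∈ F, c m • U m ∈ A.trialSpace w n :=
    Submodule.sum_mem _ fun k hk => Submodule.smul_mem _ _ (R.mem (hF k hk))
  rw [← inner_self_eq_norm_sq (𝕜 := ℂ), sum_inner, map_sum]
  refine Finset.sum_congr rfl fun k hk => ?_
  rw [inner_smul_left, R.inner_left (hF k hk) hmem, R.inner_incl_sum hF c hk, mul_left_comm,
    Complex.conj_mul', ← Complex.ofReal_pow, ← Complex.ofReal_mul]
  exact Complex.ofReal_re _

/-- The Ritz vectors span the trial space. -/
theorem eq_sum (R : A.IsRitzSystem w n (fun j => Λ j) (fun j => U j))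
    {z : A.EnergySpace} (hz : z ∈ A.trialSpace w n) :
    z = ∑ m ∈ Finset.range n, inner ℂ (incl A (U m)) (incl A z) • U m := by
  have hli : LinearIndependent ℂ fun m : Fin n => U m :=
    LinearIndependent.of_comp (incl A) R.orthonormal.linearIndependent
  have hle : Submodule.span ℂ (Set.range fun m : Fin n => U m) ≤ A.trialSpace w n :=
    Submodule.span_le.2 (by rintro _ ⟨m, rfl⟩; exact R.mem m.2)
  have heq : Submodule.span ℂ (Set.range fun m : Fin n => U m) = A.trialSpace w n := by
    refine Submodule.eq_of_le_of_finrank_le hle ?_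
    rw [finrank_span_eq_card hli]
    exact finrank_range_le_card _
  rw [← heq] at hz
  obtain ⟨c, rfl⟩ := (Submodule.mem_span_range_iff_exists_fun ℂ).1 hz
  rw [Finset.sum_range]
  refine Finset.sum_congr rfl fun k _ => ?_
  simp only [map_sum, map_smul]
  rw [R.orthonormal.inner_right_fintype]

/-- The minimum principle in the trial space. -/
theorem mul_norm_sq_incl_le (R : A.IsRitzSystem w n (fun j => Λ j) (fun j => U j)) {j : ℕ}
    (hj : j < n) {z : A.EnergySpace} (hz : z ∈ A.trialSpace w n)
    (hz0 : ∀ m < j, inner ℂ (incl A (U m)) (incl A z) = 0) :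
    Λ j * ‖incl A z‖ ^ 2 ≤ ‖z‖ ^ 2 := by
  have hF : ∀ m ∈ Finset.range n, m < n := fun m => Finset.mem_range.1
  rw [R.eq_sum hz, R.norm_sq_incl_sum hF, R.norm_sq_sum hF, Finset.mul_sum]
  refine Finset.sum_le_sum fun m hm => ?_
  rcases lt_or_ge m j with hmj | hmj
  · simp [hz0 m hmj]
  · have : Λ j ≤ Λ m := R.monotone (a := ⟨j, hj⟩) (b := ⟨m, hF m hm⟩) hmj
    gcongr

/-- Ritz values are upper bounds of the eigenvalues. -/
theorem eigenvalue_le (R : A.IsRitzSystem w n (fun j => Λ j) (fun j => U j))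
    (h : A.IsEigenListing lam u) (hA : IsCompactOperator A.inv) {j : ℕ}
    (hj : j < n) : lam j ≤ Λ j := by
  -- a unit vector in the span of `U 0, …, U j` that is orthogonal to `u 0, …, u (j - 1)`
  obtain ⟨a, ha1, ha0⟩ := exists_normalized_solution (fun k i => inner ℂ (u k) (incl A (U i))) j
  have hF : ∀ m ∈ Finset.range (j + 1), m < n := fun m hm => by
    rw [Finset.mem_range] at hm; omega
  have h1 := h.mul_norm_sq_incl_le hA (K := j)
    (z := ∑ i ∈ Finset.range (j + 1), a i • U i) fun k hk => by
      simpa only [map_sum, map_smul, inner_sum, inner_smul_right] using ha0 k hk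
  rw [R.norm_sq_incl_sum hF, R.norm_sq_sum hF, ha1, mul_one] at h1
  refine h1.trans ?_
  calc ∑ m ∈ Finset.range (j + 1), Λ m * ‖a m‖ ^ 2
      ≤ ∑ m ∈ Finset.range (j + 1), Λ j * ‖a m‖ ^ 2 := by
        refine Finset.sum_le_sum fun m hm => mul_le_mul_of_nonneg_right ?_ (by positivity)
        exact R.monotone (a := ⟨m, hF m hm⟩) (b := ⟨j, hj⟩)
          (Nat.lt_succ_iff.1 (Finset.mem_range.1 hm))
    _ = Λ j := by rw [← Finset.mul_sum, ha1, mul_one]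

/-- An upper bound for a Ritz value: its error is quadratic in the energy errors of the Galerkin projections of the
eigenvectors. -/
theorem ritz_mul_le (R : A.IsRitzSystem w n (fun j => Λ j) (fun j => U j))
    (h : A.IsEigenListing lam u) {j : ℕ} (hj : j < n) (hΛ : 0 ≤ Λ j) {D : ℝ}
    (hDdef : D = ∑ i ∈ Finset.range (j + 1), ‖h.energyVec i - A.energyProj w n (h.energyVec i)‖) :
    Λ j * (1 - 2 / lam 0 * D ^ 2) ≤ lam j := by
  -- a unit vector `v` in the span of `u 0, …, u j` whose projection is orthogonal to
  -- `U 0, …, U (j - 1)`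
  obtain ⟨a, ha1, ha0⟩ := exists_normalized_solution
    (fun k i => inner ℂ (incl A (U k)) (incl A (A.energyProj w n (h.energyVec i)))) j
  set v := ∑ i ∈ Finset.range (j + 1), a i • h.energyVec i with hv
  -- `g` is `A⁻¹ v`; the pairing `⟪v, r⟫₀ = ⟪g - P g, r⟫_{1/2}` is quadratic in the errors
  set g := ∑ i ∈ Finset.range (j + 1), ((lam i : ℂ)⁻¹ * a i) • h.energyVec i with hg
  set r := v - A.energyProj w n v with hr
  have hl0 := h.pos 0
  have ha : ∀ i ∈ Finset.range (j + 1), ‖a i‖ ≤ 1 := fun i hi => by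
    have h1 := Finset.single_le_sum (f := fun i => ‖a i‖ ^ 2) (fun i _ => by positivity) hi
    rw [ha1] at h1
    exact (sq_le_one_iff₀ (norm_nonneg _)).1 h1
  have herr : ∀ (c : ℕ → ℂ) (L : ℝ), (∀ i ∈ Finset.range (j + 1), ‖c i‖ ≤ L) →
      ‖∑ i ∈ Finset.range (j + 1), c i • h.energyVec i -
        A.energyProj w n (∑ i ∈ Finset.range (j + 1), c i • h.energyVec i)‖ ≤ L * D := by
    intro c L hc
    simp only [map_sum, map_smul]
    rw [← Finset.sum_sub_distrib, hDdef, Finset.mul_sum]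
    refine (norm_sum_le _ _).trans (Finset.sum_le_sum fun i hi => ?_)
    rw [← smul_sub, norm_smul]
    exact mul_le_mul_of_nonneg_right (hc i hi) (norm_nonneg _)
  have hrD : ‖r‖ ≤ D := by simpa only [one_mul] using herr a 1 ha
  have hgD : ‖g - A.energyProj w n g‖ ≤ (lam 0)⁻¹ * D := herr _ _ fun i hi => by
    rw [norm_mul, norm_inv, Complex.norm_real, Real.norm_of_nonneg (h.pos i).le]
    calc (lam i)⁻¹ * ‖a i‖ ≤ (lam 0)⁻¹ * 1 := by
          gcongr
          exacts [h.monotone (Nat.zero_le i), ha i hi]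
      _ = _ := mul_one _
  have hgz : ∀ z, inner ℂ g z = inner ℂ (incl A v) (incl A z) := fun z => by
    simp only [hg, hv, map_sum, map_smul, sum_inner, inner_smul_left, h.inner_energyVec,
      h.incl_energyVec]
    refine Finset.sum_congr rfl fun i _ => ?_
    have := Complex.ofReal_ne_zero.2 (h.pos i).ne'
    rw [map_mul, map_inv₀, Complex.conj_ofReal]
    field_simp
  have hgr : inner ℂ (incl A v) (incl A r) = inner ℂ (g - A.energyProj w n g) r := by
    rw [← hgz, inner_sub_left, A.inner_trial_error w n (A.energyProj_mem w n g), sub_zero]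
  have hvr : (inner ℂ (incl A v) (incl A r)).re ≤ (lam 0)⁻¹ * D ^ 2 := by
    rw [hgr]
    calc _ ≤ ‖g - A.energyProj w n g‖ * ‖r‖ :=
          (Complex.re_le_norm _).trans (norm_inner_le_norm _ _)
      _ ≤ (lam 0)⁻¹ * D * D := by
          have : 0 ≤ D := (norm_nonneg r).trans hrD
          gcongr
      _ = _ := by ring
  have hv1 : ‖incl A v‖ ^ 2 = 1 := by
    rw [← ha1, hv]
    simp only [map_sum, map_smul, h.incl_energyVec]
    exact h.norm_sq_sum_smul _ _
  have hP1 : 1 - 2 / lam 0 * D ^ 2 ≤ ‖incl A (A.energyProj w n v)‖ ^ 2 := by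
    have h1 : incl A (A.energyProj w n v) = incl A v - incl A r := by
      rw [hr, map_sub, sub_sub_cancel]
    rw [h1, @norm_sub_sq ℂ, hv1, RCLike.re_eq_complex_re]
    have : 2 / lam 0 * D ^ 2 = 2 * ((lam 0)⁻¹ * D ^ 2) := by ring
    nlinarith [norm_nonneg (incl A r)]
  have hP2 : ‖A.energyProj w n v‖ ≤ ‖v‖ := Submodule.norm_starProjection_apply_le _ v
  have hP3 := R.mul_norm_sq_incl_le hj (A.energyProj_mem w n v) fun m hm => by
    simpa only [hv, map_sum, map_smul, inner_sum, inner_smul_right] using ha0 m hm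
  calc Λ j * (1 - 2 / lam 0 * D ^ 2) ≤ Λ j * ‖incl A (A.energyProj w n v)‖ ^ 2 := by gcongr
    _ ≤ ‖A.energyProj w n v‖ ^ 2 := hP3
    _ ≤ ‖v‖ ^ 2 := by gcongr
    _ = ∑ m ∈ Finset.range (j + 1), lam m * ‖a m‖ ^ 2 := h.norm_sq_sum_energyVec _ _
    _ ≤ ∑ m ∈ Finset.range (j + 1), lam j * ‖a m‖ ^ 2 := by
        refine Finset.sum_le_sum fun m hm => mul_le_mul_of_nonneg_right ?_ (by positivity)
        exact h.monotone (Nat.lt_succ_iff.1 (Finset.mem_range.1 hm))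
    _ = lam j := by rw [← Finset.mul_sum, ha1, mul_one]

/-- The component of a Ritz vector along an eigenvector of a smaller eigenvalue. -/
theorem sub_mul_norm_coeff_le (R : A.IsRitzSystem w n (fun j => Λ j) (fun j => U j))
    (h : A.IsEigenListing lam u) {j : ℕ} (hj : j < n) (hΛ : 0 ≤ Λ j) (k : ℕ) :
    (Λ j - lam k) * ‖inner ℂ (u k) (incl A (U j))‖ ≤
      Λ j * ‖incl A (h.energyVec k - A.energyProj w n (h.energyVec k))‖ := by
  set P := A.energyProj w n (h.energyVec k) with hP
  have h1 : inner ℂ P (U j) = inner ℂ (h.energyVec k) (U j) := by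
    have h2 : inner ℂ (h.energyVec k - P) (U j) = 0 := by
      rw [← inner_conj_symm, A.inner_trial_error w n (R.mem hj), map_zero]
    rw [inner_sub_left, sub_eq_zero] at h2
    exact h2.symm
  rw [R.inner_right hj (A.energyProj_mem w n _), h.inner_energyVec] at h1
  have h3 : ((Λ j - lam k : ℝ) : ℂ) * inner ℂ (u k) (incl A (U j)) =
      (Λ j : ℂ) * inner ℂ (incl A (h.energyVec k - P)) (incl A (U j)) := by
    rw [map_sub, inner_sub_left, mul_sub, h1, h.incl_energyVec]
    push_cast; ring
  have h4 := congrArg norm h3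
  rw [norm_mul, norm_mul, Complex.norm_real, Complex.norm_real, Real.norm_of_nonneg hΛ] at h4
  have hU : ‖incl A (U j)‖ = 1 := R.orthonormal.1 ⟨j, hj⟩
  calc _ ≤ ‖Λ j - lam k‖ * ‖inner ℂ (u k) (incl A (U j))‖ := by
        gcongr; exact Real.le_norm_self _
    _ = _ := h4
    _ ≤ Λ j * (‖incl A (h.energyVec k - P)‖ * ‖incl A (U j)‖) := by
        gcongr; exact norm_inner_le_norm _ _
    _ = _ := by rw [hU, mul_one]

end IsRitzSystem

end PosDefOperator

/-! ### Spectral parts of a Ritz vector -/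

namespace PosDefOperator

open EnergySpace

variable {H : Type*} [NormedAddCommGroup H] [InnerProductSpace ℂ H] [CompleteSpace H]
  {A : PosDefOperator H} {lam : ℕ → ℝ} {u : ℕ → H}

namespace IsEigenListing

/-- The partial sum, over the indices in `F`, of the eigenvector expansion of `z`. -/
noncomputable def part (h : A.IsEigenListing lam u) (F : Finset ℕ) (z : A.EnergySpace) :
    A.EnergySpace :=
  ∑ k ∈ F, inner ℂ (u k) (incl A z) • h.energyVec k

theorem incl_part (h : A.IsEigenListing lam u) (F : Finset ℕ) (z : A.EnergySpace) :
    incl A (h.part F z) = ∑ k ∈ F, inner ℂ (u k) (incl A z) • u k := by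
  simp [part]

theorem norm_sq_part (h : A.IsEigenListing lam u) (F : Finset ℕ) (z : A.EnergySpace) :
    ‖h.part F z‖ ^ 2 = ∑ k ∈ F, lam k * ‖inner ℂ (u k) (incl A z)‖ ^ 2 :=
  h.norm_sq_sum_energyVec _ _

theorem norm_sq_incl_part (h : A.IsEigenListing lam u) (F : Finset ℕ) (z : A.EnergySpace) :
    ‖incl A (h.part F z)‖ ^ 2 = ∑ k ∈ F, ‖inner ℂ (u k) (incl A z)‖ ^ 2 := by
  rw [h.incl_part, h.norm_sq_sum_smul]

theorem inner_sub_part (h : A.IsEigenListing lam u) {F : Finset ℕ} (z : A.EnergySpace) {k : ℕ}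
    (hk : k ∈ F) : inner ℂ (u k) (incl A (z - h.part F z)) = 0 := by
  rw [map_sub, inner_sub_right, h.incl_part, h.orthonormal.inner_right_sum _ hk, sub_self]

theorem inner_part_eq_zero (h : A.IsEigenListing lam u) {F : Finset ℕ} (z : A.EnergySpace)
    {y : A.EnergySpace} (hy : ∀ k ∈ F, inner ℂ (u k) (incl A y) = 0) :
    inner ℂ (h.part F z) y = 0 := by
  rw [part, sum_inner]
  refine Finset.sum_eq_zero fun k hk => ?_
  rw [inner_smul_left, h.inner_energyVec, hy k hk, mul_zero, mul_zero]

theorem inner_incl_part_eq_zero (h : A.IsEigenListing lam u) {F : Finset ℕ} (z : A.EnergySpace)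
    {y : H} (hy : ∀ k ∈ F, inner ℂ (u k) y = 0) :
    inner ℂ (incl A (h.part F z)) y = 0 := by
  rw [incl_part, sum_inner]
  refine Finset.sum_eq_zero fun k hk => ?_
  rw [inner_smul_left, hy k hk, mul_zero]

theorem norm_sq_eq_add (h : A.IsEigenListing lam u) (F : Finset ℕ) (z : A.EnergySpace) :
    ‖z‖ ^ 2 = ∑ k ∈ F, lam k * ‖inner ℂ (u k) (incl A z)‖ ^ 2 + ‖z - h.part F z‖ ^ 2 := by
  have h1 := norm_add_sq_eq_norm_sq_add_norm_sq_of_inner_eq_zero _ _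
    (h.inner_part_eq_zero (F := F) z fun k hk => h.inner_sub_part z hk)
  rw [add_sub_cancel] at h1
  rw [← h.norm_sq_part, pow_two, h1, pow_two, pow_two]

theorem norm_sq_incl_eq_add (h : A.IsEigenListing lam u) (F : Finset ℕ) (z : A.EnergySpace) :
    ‖incl A z‖ ^ 2 = ∑ k ∈ F, ‖inner ℂ (u k) (incl A z)‖ ^ 2 +
      ‖incl A (z - h.part F z)‖ ^ 2 := by
  have h1 := norm_add_sq_eq_norm_sq_add_norm_sq_of_inner_eq_zero _ _
    (h.inner_incl_part_eq_zero (F := F) z fun k hk => h.inner_sub_part z hk)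
  rw [← map_add, add_sub_cancel] at h1
  rw [← h.norm_sq_incl_part, pow_two, h1, pow_two, pow_two]

/-- On the part of the spectrum from `lam K` on, the energy of `A⁻¹ f` is at most
`‖f‖ ^ 2 / lam K`. -/
theorem mul_norm_sq_solve_le (h : A.IsEigenListing lam u) (hA : IsCompactOperator A.inv) {K : ℕ}
    {f : H} (hf : ∀ k < K, inner ℂ (u k) (incl A (A.solve f)) = 0) :
    lam K * ‖A.solve f‖ ^ 2 ≤ ‖f‖ ^ 2 := by
  have h1 := h.mul_norm_sq_incl_le hA hf
  have h2 : ‖A.solve f‖ ^ 2 ≤ ‖f‖ * ‖incl A (A.solve f)‖ := by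
    rw [← inner_self_eq_norm_sq (𝕜 := ℂ), inner_solve]
    exact (RCLike.re_le_norm _).trans (norm_inner_le_norm _ _)
  have hK := h.pos K
  rcases (norm_nonneg (A.solve f)).eq_or_lt with h0 | h0
  · rw [← h0]; norm_num
  · have h3 : (‖A.solve f‖ ^ 2) ^ 2 ≤ ‖f‖ ^ 2 * ‖incl A (A.solve f)‖ ^ 2 := by
      rw [← mul_pow]; exact pow_le_pow_left₀ (by positivity) h2 2
    refine le_of_mul_le_mul_right ?_ (pow_pos h0 2)
    calc lam K * ‖A.solve f‖ ^ 2 * ‖A.solve f‖ ^ 2 = lam K * (‖A.solve f‖ ^ 2) ^ 2 := by ring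
      _ ≤ lam K * (‖f‖ ^ 2 * ‖incl A (A.solve f)‖ ^ 2) := by gcongr
      _ = ‖f‖ ^ 2 * (lam K * ‖incl A (A.solve f)‖ ^ 2) := by ring
      _ ≤ _ := by gcongr

end IsEigenListing

namespace IsRitzSystem

variable {w : ℕ → A.EnergySpace} {n : ℕ} {Λ : ℕ → ℝ} {U : ℕ → A.EnergySpace}

/-- The energy of the part of a Ritz vector above the eigenvalue `lam j`. -/
theorem norm_sq_upper_le (R : A.IsRitzSystem w n (fun j => Λ j) (fun j => U j))
    (h : A.IsEigenListing lam u) (hA : IsCompactOperator A.inv) {j K : ℕ} (hj : j < n) :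
    (1 - lam j / lam K) * ‖U j - h.part (Finset.range K) (U j)‖ ^ 2 ≤ Λ j - lam j +
      lam j * ∑ k ∈ Finset.range K with lam k ≠ lam j, ‖inner ℂ (u k) (incl A (U j))‖ ^ 2 := by
  set f := U j - h.part (Finset.range K) (U j) with hf
  have h1 := h.norm_sq_eq_add (Finset.range K) (U j)
  have h2 := h.norm_sq_incl_eq_add (Finset.range K) (U j)
  have hU : ‖incl A (U j)‖ = 1 := R.orthonormal.1 ⟨j, hj⟩
  rw [R.norm_sq hj] at h1
  rw [hU] at h2
  have h3 := h.mul_norm_sq_incl_le hA (K := K) (z := f) fun k hk =>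
    h.inner_sub_part (U j) (Finset.mem_range.2 hk)
  have hKp := h.pos K
  have hjp := h.pos j
  have h4 : lam j * ‖incl A f‖ ^ 2 ≤ lam j / lam K * ‖f‖ ^ 2 := by
    rw [div_mul_eq_mul_div, le_div_iff₀ hKp]
    nlinarith
  have h5 : ∑ k ∈ Finset.range K, (lam j - lam k) * ‖inner ℂ (u k) (incl A (U j))‖ ^ 2 ≤
      lam j * ∑ k ∈ Finset.range K with lam k ≠ lam j, ‖inner ℂ (u k) (incl A (U j))‖ ^ 2 := by
    rw [Finset.sum_filter, Finset.mul_sum]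
    refine Finset.sum_le_sum fun k _ => ?_
    split_ifs with hk
    · have := h.pos k
      gcongr
      linarith
    · rw [not_not] at hk
      simp [hk]
  simp only [sub_mul] at h5
  rw [Finset.sum_sub_distrib, ← Finset.mul_sum] at h5
  nlinarith

/-- The `H`-norm of the part of a Ritz vector above the eigenvalue `lam j`, by duality: the Ritz
vector is tested with the Galerkin projection of the solution of `A φ = f`, where `f` is that
part. -/
theorem norm_incl_upper_le (R : A.IsRitzSystem w n (fun j => Λ j) (fun j => U j))
    (h : A.IsEigenListing lam u) (hA : IsCompactOperator A.inv) {j K : ℕ} (hj : j < n)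
    (hΛ : 0 ≤ Λ j) {κ : ℝ} (hκ0 : 0 ≤ κ)
    (hκ : ∀ f : H, ‖A.solve f - A.energyProj w n (A.solve f)‖ ≤ κ * ‖f‖) :
    (1 - Λ j / lam K) * ‖incl A (U j - h.part (Finset.range K) (U j))‖ ≤
      Λ j * κ * ((lam j)⁻¹ + κ * (√(lam 0))⁻¹) *
        ‖U j - h.part (Finset.range K |>.filter fun k => lam k = lam j) (U j)‖ := by
  set fp := incl A (U j - h.part (Finset.range K) (U j)) with hfp
  set E := h.part (Finset.range K |>.filter fun k => lam k = lam j) (U j) with hE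
  set f := U j - E with hf
  set φ := A.solve fp with hφ
  set r := φ - A.energyProj w n φ with hr
  have hfp0 : ∀ k < K, inner ℂ (u k) fp = 0 := fun k hk =>
    h.inner_sub_part (U j) (Finset.mem_range.2 hk)
  have hφ0 : ∀ k < K, inner ℂ (u k) (incl A φ) = 0 := fun k hk => by
    have h1 := h.inner_energyVec k φ
    rw [← inner_conj_symm, hφ, inner_solve, h.incl_energyVec, inner_conj_symm, hfp0 k hk] at h1
    exact (mul_eq_zero.1 h1.symm).resolve_left (Complex.ofReal_ne_zero.2 (h.pos k).ne')
  have hφ2 := h.mul_norm_sq_solve_le hA hφ0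
  have hKp := h.pos K
  have hjp := h.pos j
  -- only the upper part of `U j` is seen by `fp` and `φ`
  have hUy : ∀ y : H, (∀ k < K, inner ℂ (u k) y = 0) →
      inner ℂ (incl A (U j)) y = inner ℂ fp y := fun y hy => by
    have h1 : inner ℂ (incl A (h.part (Finset.range K) (U j))) y = 0 :=
      h.inner_incl_part_eq_zero _ fun k hk => hy k (Finset.mem_range.1 hk)
    rw [hfp, map_sub, inner_sub_left, h1, sub_zero]
  have hU1 : inner ℂ (U j) φ = ((‖fp‖ ^ 2 : ℝ) : ℂ) := by
    rw [← inner_conj_symm, hφ, inner_solve, inner_conj_symm, hUy _ hfp0,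
      inner_self_eq_norm_sq_to_K]
    simp
  have hU2 : inner ℂ (incl A (U j)) (incl A φ) = ((‖φ‖ ^ 2 : ℝ) : ℂ) := by
    rw [hUy _ hφ0, ← inner_solve, ← hφ, inner_self_eq_norm_sq_to_K]
    simp
  have hUr : inner ℂ (U j) r = 0 := A.inner_trial_error w n (R.mem hj) φ
  have hUP : inner ℂ (U j) (A.energyProj w n φ) =
      (Λ j : ℂ) * inner ℂ (incl A (U j)) (incl A (A.energyProj w n φ)) :=
    R.inner_left hj (A.energyProj_mem w n φ)
  have hPφ : A.energyProj w n φ = φ - r := by rw [hr, sub_sub_cancel]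
  rw [hPφ, inner_sub_right, hUr, sub_zero, hU1, map_sub, inner_sub_right, hU2] at hUP
  -- the eigenspace part of `U j` can be tested in the energy inner product instead
  have hEr : (lam j : ℂ) * inner ℂ (incl A E) (incl A r) = inner ℂ E r := by
    rw [hE, IsEigenListing.incl_part, IsEigenListing.part, sum_inner, sum_inner, Finset.mul_sum]
    refine Finset.sum_congr rfl fun k hk => ?_
    rw [inner_smul_left, inner_smul_left, h.inner_energyVec, (Finset.mem_filter.1 hk).2]
    ring
  have hEf : inner ℂ E r = -inner ℂ f r := by
    rw [hf, inner_sub_left, hUr, zero_sub, neg_neg]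
  have hrn : ‖r‖ ≤ κ * ‖fp‖ := hκ fp
  have hrn0 : ‖incl A r‖ ≤ κ * (κ * ‖fp‖) :=
    (norm_incl_error_le hκ0 hκ φ).trans (by gcongr)
  have hs := h.norm_incl_le hA f
  have hUrn : ‖inner ℂ (incl A (U j)) (incl A r)‖ ≤
      κ * ((lam j)⁻¹ + κ * (√(lam 0))⁻¹) * ‖f‖ * ‖fp‖ := by
    have h1 : inner ℂ (incl A (U j)) (incl A r) =
        -((lam j : ℂ)⁻¹ * inner ℂ f r) + inner ℂ (incl A f) (incl A r) := by
      rw [← mul_neg, ← hEf, ← hEr, inv_mul_cancel_left₀ (Complex.ofReal_ne_zero.2 hjp.ne'),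
        ← inner_add_left, ← map_add, hf, add_sub_cancel]
    rw [h1]
    calc _ ≤ (lam j)⁻¹ * (‖f‖ * ‖r‖) + ‖incl A f‖ * ‖incl A r‖ := by
          refine (norm_add_le _ _).trans (add_le_add ?_ (norm_inner_le_norm _ _))
          rw [norm_neg, norm_mul, norm_inv, Complex.norm_real, Real.norm_of_nonneg hjp.le]
          gcongr
          exact norm_inner_le_norm _ _
      _ ≤ (lam j)⁻¹ * (‖f‖ * (κ * ‖fp‖)) + ((√(lam 0))⁻¹ * ‖f‖) * (κ * (κ * ‖fp‖)) := by
          gcongr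
      _ = _ := by ring
  have hre : ‖fp‖ ^ 2 - Λ j * ‖φ‖ ^ 2 ≤ Λ j * ‖inner ℂ (incl A (U j)) (incl A r)‖ := by
    have h1 : ((‖fp‖ ^ 2 - Λ j * ‖φ‖ ^ 2 : ℝ) : ℂ) =
        -((Λ j : ℂ) * inner ℂ (incl A (U j)) (incl A r)) := by
      push_cast at hUP ⊢
      rw [hUP]; ring
    have h2 := congrArg norm h1
    rw [norm_neg, norm_mul, Complex.norm_real, Complex.norm_real, Real.norm_of_nonneg hΛ] at h2
    exact (Real.le_norm_self _).trans h2.le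
  have hφ3 : Λ j * ‖φ‖ ^ 2 ≤ Λ j / lam K * ‖fp‖ ^ 2 := by
    rw [div_mul_eq_mul_div, le_div_iff₀ hKp]
    nlinarith
  rcases (norm_nonneg fp).eq_or_lt with h0 | h0
  · rw [← h0, mul_zero]; positivity
  · refine le_of_mul_le_mul_right ?_ h0
    calc (1 - Λ j / lam K) * ‖fp‖ * ‖fp‖ ≤ ‖fp‖ ^ 2 - Λ j * ‖φ‖ ^ 2 := by linarith
      _ ≤ Λ j * ‖inner ℂ (incl A (U j)) (incl A r)‖ := hre
      _ ≤ Λ j * (κ * ((lam j)⁻¹ + κ * (√(lam 0))⁻¹) * ‖f‖ * ‖fp‖) := by gcongr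
      _ = _ := by ring

end IsRitzSystem

end PosDefOperator

/-! ### Convergence rates of the Rayleigh-Ritz method -/

namespace PosDefOperator

open EnergySpace Filter Topology Asymptotics

variable {H : Type*} [NormedAddCommGroup H] [InnerProductSpace ℂ H] [CompleteSpace H]
  {A : PosDefOperator H} {lam : ℕ → ℝ} {u : ℕ → H}

/-- A normalized element whose eigenspace part is close to it is close to a normalized
eigenvector. -/
theorem IsEigenListing.exists_eigenvector_near (h : A.IsEigenListing lam u) {F : Finset ℕ} {ν : ℝ}
    (hF : ∀ k ∈ F, lam k = ν) {z : A.EnergySpace} (hz : ‖incl A z‖ = 1)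
    (hlt : ‖incl A (z - h.part F z)‖ < 1) :
    ∃ e : A.domain, A.app e = (ν : ℂ) • (e : H) ∧ ‖(e : H)‖ = 1 ∧
      ‖ofDomain A e - z‖ ≤ ‖z - h.part F z‖ + √ν * ‖incl A (z - h.part F z)‖ ∧
      ‖(e : H) - incl A z‖ ≤ 2 * ‖incl A (z - h.part F z)‖ := by
  set E := h.part F z with hE
  set N := ‖incl A E‖ with hN
  have hsub : |N - 1| ≤ ‖incl A (z - E)‖ := by
    rw [← hz, hN, map_sub, norm_sub_rev]
    exact abs_norm_sub_norm_le _ _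
  have hN0 : 0 < N := by
    have := (abs_le.1 hsub).1
    linarith
  have hEN : ‖E‖ = √ν * N := by
    have h1 : ‖E‖ ^ 2 = ν * N ^ 2 := by
      rw [hE, h.norm_sq_part, hN, h.norm_sq_incl_part, Finset.mul_sum]
      exact Finset.sum_congr rfl fun k hk => by rw [hF k hk]
    rw [← Real.sqrt_sq (norm_nonneg E), h1, Real.sqrt_mul' _ (sq_nonneg N), Real.sqrt_sq hN0.le]
  set d : A.domain := ∑ k ∈ F, inner ℂ (u k) (incl A z) • (⟨u k, h.mem k⟩ : A.domain) with hd
  have hdE : (d : H) = incl A E := by simp [hd, hE, h.incl_part]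
  have hdapp : A.app d = (ν : ℂ) • (d : H) := by
    rw [hdE, hE, h.incl_part, hd, app, Finset.smul_sum]
    refine (map_sum A.op.toFun _ _).trans (Finset.sum_congr rfl fun k hk => ?_)
    rw [smul_comm, ← hF k hk, ← h.eigen k]
    exact A.op.map_smul _ ⟨u k, h.mem k⟩
  have hscal : ‖((N⁻¹ : ℝ) : ℂ) - 1‖ * N = |N - 1| := by
    rw [← Complex.ofReal_one, ← Complex.ofReal_sub, Complex.norm_real, Real.norm_eq_abs,
      ← abs_of_pos hN0, ← abs_mul, abs_of_pos hN0, sub_mul, inv_mul_cancel₀ hN0.ne', one_mul,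
      abs_sub_comm]
  refine ⟨((N⁻¹ : ℝ) : ℂ) • d, ?_, ?_, ?_, ?_⟩
  · refine (A.op.map_smul _ d).trans ?_
    change ((N⁻¹ : ℝ) : ℂ) • A.app d = _
    rw [hdapp, smul_comm]
    rfl
  · rw [Submodule.coe_smul, norm_smul, hdE, Complex.norm_real, Real.norm_of_nonneg (by positivity)]
    exact inv_mul_cancel₀ hN0.ne'
  · have h1 : ofDomain A (((N⁻¹ : ℝ) : ℂ) • d) - z =
        (((N⁻¹ : ℝ) : ℂ) - 1) • E - (z - E) := by
      apply incl_injective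
      simp only [map_sub, map_smul, incl_ofDomain, Submodule.coe_smul, hdE, sub_smul, one_smul]
      abel
    rw [h1]
    refine (norm_sub_le _ _).trans ?_
    rw [norm_smul, hEN, add_comm, mul_left_comm, hscal]
    gcongr
  · have h1 : ((((N⁻¹ : ℝ) : ℂ) • d : A.domain) : H) - incl A z =
        (((N⁻¹ : ℝ) : ℂ) - 1) • incl A E - incl A (z - E) := by
      simp only [map_sub, Submodule.coe_smul, hdE, sub_smul, one_smul]
      abel
    rw [h1]
    refine (norm_sub_le _ _).trans ?_
    rw [norm_smul, ← hN, hscal]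
    linarith

/-- Rates for the Rayleigh-Ritz method in terms of the Galerkin errors: `κ n` is the rate of the
duality estimate and `p n` is the sum of the energy errors for the eigenvectors up to index `j`. -/
theorem ritz_isBigO (h : A.IsEigenListing lam u) (hA : IsCompactOperator A.inv)
    {w : ℕ → A.EnergySpace} {Λ : ℕ → ℕ → ℝ} {U : ℕ → ℕ → A.EnergySpace}
    (R : ∀ n, A.IsRitzSystem w n (fun j => Λ n j) (fun j => U n j))
    {κ p : ℕ → ℝ} (hκ0 : ∀ n, 0 ≤ κ n)
    (hκ : ∀ n f, ‖A.solve f - A.energyProj w n (A.solve f)‖ ≤ κ n * ‖f‖)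
    (hκlim : Tendsto κ atTop (𝓝 0)) (j : ℕ)
    (hpdef : ∀ n, p n =
      ∑ i ∈ Finset.range (j + 1), ‖h.energyVec i - A.energyProj w n (h.energyVec i)‖)
    (hplim : Tendsto p atTop (𝓝 0)) :
    (fun n => Λ n j - lam j) =O[atTop] (fun n => p n ^ 2) ∧
    ∃ e : ℕ → A.domain,
      (∀ n, A.app (e n) = (lam j : ℂ) • (e n : H) ∧ ‖(e n : H)‖ = 1) ∧
      (fun n => ofDomain A (e n) - U n j) =O[atTop] p ∧
      (fun n => (e n : H) - incl A (U n j)) =O[atTop] fun n => κ n * p n := by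
  have hp0 : ∀ n, 0 ≤ p n := fun n => by
    rw [hpdef]; exact Finset.sum_nonneg fun i _ => norm_nonneg _
  have hjp := h.pos j
  have h0p := h.pos 0
  -- the first index whose eigenvalue exceeds `lam j`
  obtain ⟨K, hKj, hKle⟩ : ∃ K, lam j < lam K ∧ ∀ k < K, lam k ≤ lam j := by
    have hex := ((h.tendsto_atTop hA).eventually_gt_atTop (lam j)).exists
    exact ⟨Nat.find hex, Nat.find_spec hex, fun k hk => not_lt.1 (Nat.find_min hex hk)⟩
  have hlarge : ∀ᶠ n in atTop, j < n := eventually_gt_atTop j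
  have hsmall : ∀ᶠ n in atTop, 2 / lam 0 * p n ^ 2 ≤ 1 / 2 := by
    have h1 : Tendsto (fun n => 2 / lam 0 * p n ^ 2) atTop (𝓝 0) := by
      simpa using (hplim.pow 2).const_mul (2 / lam 0)
    exact h1.eventually_le_const (by norm_num)
  -- Ritz values
  have hΛ : ∀ᶠ n in atTop, lam j ≤ Λ n j ∧ Λ n j ≤ 2 * lam j ∧
      Λ n j - lam j ≤ 4 * lam j / lam 0 * p n ^ 2 := by
    filter_upwards [hlarge, hsmall] with n hn hs
    have h1 := (R n).eigenvalue_le h hA hn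
    have h2 := (R n).ritz_mul_le h hn (hjp.le.trans h1) (hpdef n)
    have h3 : Λ n j ≤ 2 * lam j := by nlinarith
    refine ⟨h1, h3, ?_⟩
    have h4 : Λ n j * (2 / lam 0 * p n ^ 2) ≤ 2 * lam j * (2 / lam 0 * p n ^ 2) := by gcongr
    calc Λ n j - lam j ≤ Λ n j * (2 / lam 0 * p n ^ 2) := by linarith
      _ ≤ _ := h4
      _ = _ := by ring
  have hΛO : (fun n => Λ n j - lam j) =O[atTop] fun n => p n ^ 2 := by
    refine IsBigO.of_bound (4 * lam j / lam 0) ?_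
    filter_upwards [hΛ] with n hn
    rw [Real.norm_of_nonneg (by linarith), Real.norm_of_nonneg (by positivity)]
    exact hn.2.2
  have hΛlim : Tendsto (fun n => Λ n j) atTop (𝓝 (lam j)) := by
    have h1 := hΛO.trans_tendsto (by simpa using hplim.pow 2)
    simpa using h1.add_const (lam j)
  have hκ1 : κ =O[atTop] fun _ => (1 : ℝ) := hκlim.isBigO_one ℝ
  have hκp : (fun n => κ n * p n) =O[atTop] p := by
    simpa using hκ1.mul (isBigO_refl p atTop)
  -- components along the smaller eigenvalues
  have hcoef : ∀ k ∈ Finset.range K |>.filter fun k => lam k ≠ lam j,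
      (fun n => inner ℂ (u k) (incl A (U n j))) =O[atTop] fun n => κ n * p n := by
    intro k hk
    rw [Finset.mem_filter, Finset.mem_range] at hk
    have hlt : lam k < lam j := (hKle k hk.1).lt_of_ne hk.2
    have hkj : k < j := by
      by_contra! hjk
      exact absurd (h.monotone hjk) (not_le.2 hlt)
    refine IsBigO.of_bound (2 * lam j / (lam j - lam k)) ?_
    filter_upwards [hlarge, hΛ] with n hn hΛn
    have h1 := (R n).sub_mul_norm_coeff_le h hn (hjp.le.trans hΛn.1) k
    have h2 : ‖incl A (h.energyVec k - A.energyProj w n (h.energyVec k))‖ ≤ κ n * p n := by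
      refine (norm_incl_error_le (hκ0 n) (hκ n) _).trans ?_
      refine mul_le_mul_of_nonneg_left ?_ (hκ0 n)
      rw [hpdef]
      exact Finset.single_le_sum
        (f := fun i => ‖h.energyVec i - A.energyProj w n (h.energyVec i)‖)
        (fun i _ => norm_nonneg _) (Finset.mem_range.2 (by omega))
    rw [Real.norm_of_nonneg (mul_nonneg (hκ0 n) (hp0 n)), div_mul_eq_mul_div,
      le_div_iff₀ (sub_pos.2 hlt), mul_comm]
    calc (lam j - lam k) * ‖inner ℂ (u k) (incl A (U n j))‖
        ≤ (Λ n j - lam k) * ‖inner ℂ (u k) (incl A (U n j))‖ := by gcongr; exact hΛn.1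
      _ ≤ _ := h1
      _ ≤ 2 * lam j * (κ n * p n) := by
          have := mul_nonneg (hκ0 n) (hp0 n)
          gcongr
          exact hΛn.2.1
  set Fs := Finset.range K |>.filter fun k => lam k ≠ lam j with hFs
  set Fe := Finset.range K |>.filter fun k => lam k = lam j with hFe
  have hpart : ∀ z, h.part (Finset.range K) z = h.part Fe z + h.part Fs z := fun z =>
    (Finset.sum_filter_add_sum_filter_not _ _ _).symm
  have hlow : (fun n => h.part Fs (U n j)) =O[atTop] fun n => κ n * p n := by
    refine IsBigO.fun_sum (A := fun k n => inner ℂ (u k) (incl A (U n j)) • h.energyVec k)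
      fun k hk => ?_
    have h1 := (hcoef k hk).smul (isBigO_const_const (h.energyVec k) (one_ne_zero (α := ℝ)) atTop)
    simpa only [smul_eq_mul, mul_one] using h1
  have hlow0 : (fun n => incl A (h.part Fs (U n j))) =O[atTop] fun n => κ n * p n :=
    ((inclL A).isBigO_comp _ _).trans hlow
  -- the upper part, in the energy norm
  have hδ : 0 < 1 - lam j / lam K := sub_pos.2 ((div_lt_one (h.pos K)).2 hKj)
  have hupper : (fun n => U n j - h.part (Finset.range K) (U n j)) =O[atTop] p := by
    have h1 : (fun n => (1 - lam j / lam K)⁻¹ *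
        (Λ n j - lam j + lam j * ‖incl A (h.part Fs (U n j))‖ ^ 2)) =O[atTop] fun n => p n ^ 2 :=
      (hΛO.add (((hlow0.trans hκp).norm_left.pow 2).const_mul_left _)).const_mul_left _
    refine IsBigO.of_norm_left (IsBigO.of_pow two_ne_zero (IsBigO.trans ?_ h1))
    refine IsBigO.of_bound 1 ?_
    filter_upwards [hlarge] with n hn
    have h2 := (R n).norm_sq_upper_le h hA hn (K := K)
    rw [← h.norm_sq_incl_part, ← le_div_iff₀' hδ, div_eq_inv_mul] at h2
    rw [one_mul, Pi.pow_apply, Real.norm_of_nonneg (by positivity)]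
    exact h2.trans (Real.le_norm_self _)
  have hsplit : ∀ n, U n j - h.part Fe (U n j) =
      (U n j - h.part (Finset.range K) (U n j)) + h.part Fs (U n j) := fun n => by
    rw [hpart]; abel
  have hf : (fun n => U n j - h.part Fe (U n j)) =O[atTop] p := by
    simp only [hsplit]
    exact hupper.add (hlow.trans hκp)
  -- the upper part, in `H`
  have hupper0 : (fun n => incl A (U n j - h.part (Finset.range K) (U n j))) =O[atTop]
      fun n => κ n * p n := by
    have h1 : (fun n => (2 / (1 - lam j / lam K) * (2 * lam j) * ((lam j)⁻¹ + (√(lam 0))⁻¹)) *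
        (κ n * ‖U n j - h.part Fe (U n j)‖)) =O[atTop] fun n => κ n * p n :=
      ((isBigO_refl κ atTop).mul hf.norm_left).const_mul_left _
    refine IsBigO.trans (IsBigO.of_bound 1 ?_) h1
    have hgap : ∀ᶠ n in atTop, (1 - lam j / lam K) / 2 ≤ 1 - Λ n j / lam K := by
      have h2 : Tendsto (fun n => 1 - Λ n j / lam K) atTop (𝓝 (1 - lam j / lam K)) :=
        (hΛlim.div_const _).const_sub _
      exact h2.eventually_const_le (by linarith)
    filter_upwards [hlarge, hΛ, hgap, hκlim.eventually_le_const one_pos] with n hn hΛn hg hκn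
    have h2 := (R n).norm_incl_upper_le h hA hn (hjp.le.trans hΛn.1) (hκ0 n) (hκ n) (K := K)
    have hκn0 := hκ0 n
    have h3 : (1 - lam j / lam K) / 2 *
        ‖incl A (U n j - h.part (Finset.range K) (U n j))‖ ≤
        2 * lam j * κ n * ((lam j)⁻¹ + 1 * (√(lam 0))⁻¹) * ‖U n j - h.part Fe (U n j)‖ := by
      refine (mul_le_mul_of_nonneg_right hg (norm_nonneg _)).trans (h2.trans ?_)
      gcongr
      exact hΛn.2.1
    rw [← le_div_iff₀' (by positivity)] at h3
    rw [one_mul]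
    refine h3.trans (le_trans (le_of_eq ?_) (Real.le_norm_self _))
    field_simp
  have hf0 : (fun n => incl A (U n j - h.part Fe (U n j))) =O[atTop] fun n => κ n * p n := by
    simp only [hsplit, map_add]
    exact hupper0.add hlow0
  have hf0lim : Tendsto (fun n => ‖incl A (U n j - h.part Fe (U n j))‖) atTop (𝓝 0) := by
    have h1 : Tendsto (fun n => κ n * p n) atTop (𝓝 0) := by simpa using hκlim.mul hplim
    simpa using (hf0.trans_tendsto h1).norm
  -- the normalized eigenspace parts; an arbitrary eigenvector where they may vanish
  have hchoice : ∀ n, ∃ e : A.domain, (A.app e = (lam j : ℂ) • (e : H) ∧ ‖(e : H)‖ = 1) ∧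
      (j < n → ‖incl A (U n j - h.part Fe (U n j))‖ < 1 →
        ‖ofDomain A e - U n j‖ ≤ ‖U n j - h.part Fe (U n j)‖ +
          √(lam j) * ‖incl A (U n j - h.part Fe (U n j))‖ ∧
        ‖(e : H) - incl A (U n j)‖ ≤ 2 * ‖incl A (U n j - h.part Fe (U n j))‖) := by
    intro n
    by_cases hn : j < n ∧ ‖incl A (U n j - h.part Fe (U n j))‖ < 1
    · obtain ⟨e, he1, he2, he3, he4⟩ := h.exists_eigenvector_near
        (fun k hk => (Finset.mem_filter.1 hk).2) ((R n).orthonormal.1 ⟨j, hn.1⟩) hn.2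
      exact ⟨e, ⟨he1, he2⟩, fun _ _ => ⟨he3, he4⟩⟩
    · exact ⟨⟨u j, h.mem j⟩, ⟨h.eigen j, h.orthonormal.1 j⟩, fun h1 h2 => absurd ⟨h1, h2⟩ hn⟩
  choose e he hnear using hchoice
  have hnear' : ∀ᶠ n in atTop,
      ‖ofDomain A (e n) - U n j‖ ≤ ‖U n j - h.part Fe (U n j)‖ +
        √(lam j) * ‖incl A (U n j - h.part Fe (U n j))‖ ∧
      ‖(e n : H) - incl A (U n j)‖ ≤ 2 * ‖incl A (U n j - h.part Fe (U n j))‖ := by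
    filter_upwards [hlarge, hf0lim.eventually_lt_const one_pos] with n h1 h2
    exact hnear n h1 h2
  refine ⟨hΛO, e, he, ?_, ?_⟩
  · refine IsBigO.trans (IsBigO.of_bound 1 ?_)
      (hf.norm_left.add ((hf0.trans hκp).norm_left.const_mul_left √(lam j)))
    filter_upwards [hnear'] with n hn
    rw [one_mul]
    exact hn.1.trans (Real.le_norm_self _)
  · refine IsBigO.trans (IsBigO.of_bound 1 ?_) (hf0.norm_left.const_mul_left 2)
    filter_upwards [hnear'] with n hn
    rw [one_mul]
    exact hn.2.trans (Real.le_norm_self _)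

end PosDefOperator

/-! ### The error estimates -/

/-- `A⁻¹` is compact when `M⁻¹` is and the graph norm of `A` dominates that of `M`. -/
theorem PosDefOperator.isCompactOperator_inv
    {H : Type*} [NormedAddCommGroup H] [InnerProductSpace ℂ H] [CompleteSpace H]
    {G : Type*} [NormedAddCommGroup G] [InnerProductSpace ℂ G] [CompleteSpace G]
    (J : G ≃L[ℂ] H) (A : PosDefOperator H) (M : PosDefOperator G) (hM : IsCompactOperator M.inv)
    (hD : ∀ x : G, x ∈ M.domain ↔ J x ∈ A.domain) {c : ℝ} (hc : 0 < c)
    (hnorm : ∀ (x : G) (hx : x ∈ M.domain),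
      c * ‖M.app ⟨x, hx⟩‖ ≤ ‖A.app ⟨J x, (hD x).1 hx⟩‖) :
    IsCompactOperator A.inv := by
  have hcomp := hM.isCompact_closure_image_of_bounded (f := (M.inv : G →ₗ[ℂ] G))
    (S := Metric.closedBall 0 c⁻¹) Metric.isBounded_closedBall
  refine ⟨J '' _, hcomp.image J.continuous, Filter.mem_of_superset
    (Metric.closedBall_mem_nhds 0 one_pos) fun f hf => ?_⟩
  have hvm : J.symm (A.inv f) ∈ M.domain := by
    rw [hD, J.apply_symm_apply]; exact A.inv_mem f
  refine ⟨J.symm (A.inv f), subset_closure ⟨M.app ⟨_, hvm⟩, ?_, M.inv_app _⟩, J.apply_symm_apply _⟩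
  have h1 := hnorm _ hvm
  rw [show A.app ⟨J (J.symm (A.inv f)), (hD _).1 hvm⟩ = f from
    (congrArg A.app (Subtype.ext (J.apply_symm_apply _))).trans (A.app_inv f)] at h1
  rw [mem_closedBall_zero_iff] at hf ⊢
  rw [← one_div, le_div_iff₀ hc]
  linarith

theorem theorem4p5
    {H : Type*} [NormedAddCommGroup H] [InnerProductSpace ℂ H] [CompleteSpace H]
    {G : Type*} [NormedAddCommGroup G] [InnerProductSpace ℂ G] [CompleteSpace G]
    -- `G` and `H` consist of the same elements (identified by `J`), with equivalent norms
    (J : G ≃L[ℂ] H)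
    (A : PosDefOperator H) (M : PosDefOperator G)
    (hM : IsCompactOperator M.inv)
    (μ : ℕ → ℝ) (q : ℕ → G) (hq : M.IsEigenListing μ q)
    -- `D(A) = D(M)` with equivalent norms
    (hD : ∀ x : G, x ∈ M.domain ↔ J x ∈ A.domain)
    (hnorm : ∃ c C : ℝ, 0 < c ∧ 0 < C ∧ ∀ (x : G) (hx : x ∈ M.domain),
      c * ‖M.app ⟨x, hx⟩‖ ≤ ‖A.app ⟨J x, (hD x).1 hx⟩‖ ∧
      ‖A.app ⟨J x, (hD x).1 hx⟩‖ ≤ C * ‖M.app ⟨x, hx⟩‖)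
    -- the trial vectors are the eigenvectors of `M`
    (w : ℕ → A.EnergySpace)
    (hw : w = fun k => PosDefOperator.EnergySpace.ofDomain A ⟨J (q k), (hD (q k)).1 (hq.mem k)⟩)
    (σ : ℝ) (hσ : 1 / 2 ≤ σ) :
    (∀ v : G, v ∈ (M.rpow σ).domain →
      ∃ v' : A.EnergySpace, PosDefOperator.EnergySpace.incl A v' = J v ∧
        (fun n : ℕ => ‖PosDefOperator.EnergySpace.incl A (v' - A.energyProj w n v')‖)
          =o[Filter.atTop] fun n : ℕ => μ n ^ (-σ)) ∧
    (∀ (lam : ℕ → ℝ) (u : ℕ → H), A.IsEigenListing lam u →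
      ∀ (Λ : ℕ → ℕ → ℝ) (U : ℕ → ℕ → A.EnergySpace),
      (∀ n, A.IsRitzSystem w n (fun j => Λ n j) (fun j => U n j)) →
      ∀ l : ℕ, (∀ j < l, J.symm (u j) ∈ (M.rpow σ).domain) →
      ∀ j < l,
        (fun n : ℕ => Λ n j - lam j) =o[Filter.atTop] (fun n : ℕ => μ n ^ (1 - 2 * σ)) ∧
        ∃ e : ℕ → A.domain,
          (∀ n, A.app (e n) = (lam j : ℂ) • (e n : H) ∧ ‖(e n : H)‖ = 1) ∧
          (fun n : ℕ => ‖PosDefOperator.EnergySpace.ofDomain A (e n) - U n j‖)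
            =o[Filter.atTop] (fun n : ℕ => μ n ^ (1 / 2 - σ)) ∧
          (fun n : ℕ => ‖(e n : H) - PosDefOperator.EnergySpace.incl A (U n j)‖)
            =o[Filter.atTop] (fun n : ℕ => μ n ^ (-σ))) := by
  obtain ⟨c, C, hc, hC, hcC⟩ := hnorm
  have hlower : ∀ (x : G) (hx : x ∈ M.domain),
      c * ‖M.app ⟨x, hx⟩‖ ≤ ‖A.app ⟨J x, (hD x).1 hx⟩‖ := fun x hx => (hcC x hx).1
  have hw' : ∀ k, w k = PosDefOperator.EnergySpace.ofDomain A
      ⟨J (q k), (hD (q k)).1 (hq.mem k)⟩ := fun k => by rw [hw]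
  obtain ⟨K, hK0, hK⟩ := PosDefOperator.exists_energy_le J A M (fun x => (hD x).1) hC
    fun x hx => (hcC x hx).2
  obtain ⟨B, hB0, hB⟩ := PosDefOperator.exists_solve_error_le hq hM hD hc hlower hK0 hK hw'
  set κ : ℕ → ℝ := fun n => B * μ n ^ (-(1 / 2) : ℝ) with hκdef
  have hκ0 : ∀ n, 0 ≤ κ n := fun n => mul_nonneg hB0.le (Real.rpow_nonneg (hq.pos n).le _)
  have hκO : κ =O[Filter.atTop] fun n => μ n ^ (-(1 / 2) : ℝ) :=
    (Asymptotics.isBigO_refl _ _).const_mul_left B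
  have hμmul : ∀ n, μ n ^ (-(1 / 2) : ℝ) * μ n ^ (1 / 2 - σ) = μ n ^ (-σ) := fun n => by
    rw [← Real.rpow_add (hq.pos n)]; ring_nf
  have herr : ∀ v ∈ (M.rpow σ).domain, ∃ v' : A.EnergySpace,
      PosDefOperator.EnergySpace.incl A v' = J v ∧
        (fun n => ‖v' - A.energyProj w n v'‖) =o[Filter.atTop] fun n => μ n ^ (1 / 2 - σ) :=
    fun v hv => PosDefOperator.exists_energy_error_isLittleO hq hM (fun x => (hD x).1) hK0 hK hw'
      hσ hv
  refine ⟨fun v hv => ?_, fun lam u hu Λ U R l hl j hj => ?_⟩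
  · obtain ⟨v', hv', ho⟩ := herr v hv
    refine ⟨v', hv', ?_⟩
    have h1 := hκO.mul_isLittleO ho
    simp only [hμmul] at h1
    refine Asymptotics.IsBigO.trans_isLittleO (Asymptotics.IsBigO.of_bound 1 ?_) h1
    refine Filter.Eventually.of_forall fun n => ?_
    rw [one_mul, norm_norm]
    exact (PosDefOperator.norm_incl_error_le (hκ0 n) (hB n) v').trans (Real.le_norm_self _)
  · have hA := PosDefOperator.isCompactOperator_inv J A M hM hD hc hlower
    have hμlim := hq.tendsto_atTop hM
    have hκlim : Filter.Tendsto κ Filter.atTop (nhds 0) := by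
      rw [← mul_zero B]
      exact ((tendsto_rpow_neg_atTop (y := 1 / 2) (by norm_num)).comp hμlim).const_mul B
    set p : ℕ → ℝ := fun n => ∑ i ∈ Finset.range (j + 1),
      ‖hu.energyVec i - A.energyProj w n (hu.energyVec i)‖ with hp
    have hpo : p =o[Filter.atTop] fun n => μ n ^ (1 / 2 - σ) := by
      refine Asymptotics.IsLittleO.fun_sum
        (A := fun i n => ‖hu.energyVec i - A.energyProj w n (hu.energyVec i)‖) fun i hi => ?_
      obtain ⟨v', hv', ho⟩ := herr _ (hl i (by rw [Finset.mem_range] at hi; omega))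
      have hv'e : v' = hu.energyVec i := by
        apply PosDefOperator.EnergySpace.incl_injective
        rw [hv', J.apply_symm_apply, hu.incl_energyVec]
      rwa [hv'e] at ho
    have hμ1 : (fun n => μ n ^ (1 / 2 - σ)) =O[Filter.atTop] fun _ => (1 : ℝ) := by
      refine Asymptotics.IsBigO.of_bound (μ 0 ^ (1 / 2 - σ)) (Filter.Eventually.of_forall fun n => ?_)
      rw [norm_one, mul_one, Real.norm_of_nonneg (Real.rpow_nonneg (hq.pos n).le _)]
      exact Real.rpow_le_rpow_of_nonpos (hq.pos 0) (hq.monotone (Nat.zero_le n)) (by linarith)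
    have hplim : Filter.Tendsto p Filter.atTop (nhds 0) :=
      (Asymptotics.isLittleO_one_iff ℝ).1 (hpo.trans_isBigO hμ1)
    obtain ⟨h1, e, he, h2, h3⟩ := PosDefOperator.ritz_isBigO hu hA R hκ0 hB hκlim j
      (fun n => rfl) hplim
    have hp2 : (fun n => p n ^ 2) =o[Filter.atTop] fun n => μ n ^ (1 - 2 * σ) := by
      have h4 := hpo.pow two_pos
      refine h4.congr_right fun n => ?_
      rw [← Real.rpow_natCast, ← Real.rpow_mul (hq.pos n).le]
      push_cast; ring_nf
    have hκp := hκO.mul_isLittleO hpo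
    simp only [hμmul] at hκp
    exact ⟨h1.trans_isLittleO hp2, e, he, (h2.trans_isLittleO hpo).norm_left,
      (h3.trans_isLittleO hκp).norm_left⟩
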